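/- Let $\mathcal K$ be a field, $n\ge 0$, and $\xi\in\mathcal K^\times$. For $k\in\mathbb Z$ put $[k]=1+\xi+\dots+\xi^{k-1}$ if $k\ge 0$ and $[k]=-(\xi^{-1}+\dots+\xi^{k})$ if $k<0$. Assume that the quantum characteristic $e=\min\{k>0 : [k]=0\}$ (with $e=\infty$ if there is no such $k$) satisfies $e>2$. Let $\boldsymbol\kappa=(\kappa_1,\dots,\kappa_\ell)\in\mathbb Z^\ell$ be a symmetric multicharge, that is, $\kappa_i=-\kappa_{\ell+1-i}$ for all $i$. Let $\mathscr H_n=\mathscr H_n(\mathcal K)$ be the cyclotomic Hecke algebra: the unital associative $\mathcal K$-algebra generated by $L_1,\dots,L_n,T_1,\dots,T_{n-1}$ subject to $\prod_{i=1}^{\ell}(L_1-[\kappa_i])=0$, $(T_r+1)(T_r-\xi)=0$, $L_rL_s=L_sL_r$, $T_rT_s=T_sT_r$ for $|r-s|>1$, $T_rT_{r+1}T_r=T_{r+1}T_rT_{r+1}$, $T_rL_s=L_sT_r$ for $s\ne r,r+1$, and $L_{r+1}(T_r-\xi+1)=T_rL_r+1$. Let $\#$ be the unique algebra endomorphism of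 $\mathscr H_n$ with $T_r^\#=-\xi T_r^{-1}$ for $1\le r<n$ and, if $n\ge1$, $L_1^\#=-L_1$ if $\xi=1$, and $\widetilde L_1^{\,\#}=\widetilde L_1^{\,-1}$ with $\widetilde L_1=(\xi-1)L_1+1$ if $\xi\ne1$. Let $\mathscr H_n^\#=\{h\in\mathscr H_n : h^\#=h\}$ be the alternating cyclotomic Hecke algebra. For an $\ell$-multipartition $\boldsymbol\lambda=(\lambda^{(1)},\dots,\lambda^{(\ell)})$ of $n$, let $\boldsymbol\lambda'$ be its conjugate, obtained by reversing the order of the components and transposing each of them, and let $\mathrm{Std}(\boldsymbol\lambda)$ be the set of standard $\boldsymbol\lambda$-tableaux. If $k$ lies in row $a$ and column $b$ of component $l$ of $\mathfrak t$, put $c_k(\mathfrak t)=\kappa_l+b-a$, and put $\rho_r(\mathfrak t)=c_r(\mathfrak t)-c_{r+1}(\mathfrak t)$. Let $s_r\mathfrak t$ be the tableau obtained from $\mathfrak t$ by exchanging $r$ and $r+1$. A seminormal coefficient system in $\mathcal K$ is a family of scalars $\alpha_r(\mathfrak t)\in\mathcal K$, for $1\le r<n$ and $\mathfrak t$ a standard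 tableau of any $\ell$-multipartition of $n$, such that (reading $\alpha_r(\mathfrak u)=0$ when $\mathfrak u$ is not standard), for all standard $\mathfrak t$, 1. $\alpha_k(\mathfrak t)\alpha_m(s_k\mathfrak t)=\alpha_m(\mathfrak t)\alpha_k(s_m\mathfrak t)$ for $1\le k,m<n$ with $|k-m|>1$; 2. $\alpha_r(s_{r+1}s_r\mathfrak t)\,\alpha_{r+1}(s_r\mathfrak t)\,\alpha_r(\mathfrak t)=\alpha_{r+1}(s_rs_{r+1}\mathfrak t)\,\alpha_r(s_{r+1}\mathfrak t)\,\alpha_{r+1}(\mathfrak t)$ for $1\le r\le n-2$; 3. for $1\le r<n$ and $\mathfrak v=s_r\mathfrak t$: $\alpha_r(\mathfrak t)=0$ if $\mathfrak v$ is not standard, and otherwise $\alpha_r(\mathfrak t)\alpha_r(\mathfrak v)=\dfrac{[1+\rho_r(\mathfrak t)][1+\rho_r(\mathfrak v)]}{[\rho_r(\mathfrak t)][\rho_r(\mathfrak v)]}$. Suppose that $$P_{\mathscr H}=[1][2]\cdots[n]\prod_{1\le r<s\le\ell}\ \prod_{-n<d<n}[\kappa_r+d-\kappa_s]\neq0\quad\text{in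 }\mathcal K,$$ and let $\boldsymbol\alpha$ be a seminormal coefficient system in $\mathcal K$. The Specht module $S^{\boldsymbol\lambda}$ is the $\mathscr H_n$-module with $\mathcal K$-basis $\{f_{\mathfrak t} : \mathfrak t\in\mathrm{Std}(\boldsymbol\lambda)\}$ and action $$L_kf_{\mathfrak t}=[c_k(\mathfrak t)]f_{\mathfrak t},\qquad T_rf_{\mathfrak t}=\alpha_r(\mathfrak t)f_{s_r\mathfrak t}-\frac1{[\rho_r(\mathfrak t)]}f_{\mathfrak t},$$ where $f_{s_r\mathfrak t}=0$ if $s_r\mathfrak t$ is not standard. Then for every $\ell$-multipartition $\boldsymbol\lambda$ of $n$ with $\boldsymbol\lambda\ne\boldsymbol\lambda'$, the restriction $S^{[\boldsymbol\lambda]}$ of $S^{\boldsymbol\lambda}$ to $\mathscr H_n^\#$ is an irreducible $\mathscr H_n^\#$-module. -/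

import Mathlib

namespace CycHecke

noncomputable section

/-- The quantum integer `[k]_ξ`. -/
def qInt {R : Type*} [CommRing R] (ξ : Rˣ) : ℤ → R
  | Int.ofNat k => ∑ i ∈ Finset.range k, (ξ : R) ^ i
  | Int.negSucc k => -∑ i ∈ Finset.range (k + 1), ((ξ⁻¹ : Rˣ) : R) ^ (i + 1)

/-- The quantum characteristic: the least `k > 0` with `1 + ξ + ⋯ + ξ ^ (k - 1) = 0`,
or `⊤` if there is none. -/
def quantumChar {R : Type*} [CommRing R] (ξ : Rˣ) : ℕ∞ :=
  sInf {m : ℕ∞ | ∃ k : ℕ, 0 < k ∧ ∑ i ∈ Finset.range k, (ξ : R) ^ i = 0 ∧ m = k}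

theorem qInt_zero {R : Type*} [CommRing R] (ξ : Rˣ) : qInt ξ 0 = 0 := by
  change qInt ξ (Int.ofNat 0) = 0
  simp [qInt]

theorem qInt_succ {R : Type*} [CommRing R] (ξ : Rˣ) (k : ℤ) :
    qInt ξ (k + 1) = qInt ξ k + ((ξ ^ k : Rˣ) : R) := by
  match k with
  | Int.ofNat k =>
    change qInt ξ (Int.ofNat (k + 1)) = _
    simp [qInt, Finset.sum_range_succ]
  | Int.negSucc 0 =>
    change qInt ξ (Int.ofNat 0) = _
    simp [qInt]
  | Int.negSucc (k + 1) =>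
    change qInt ξ (Int.negSucc k) = _
    simp only [qInt, zpow_negSucc]
    rw [Finset.sum_range_succ _ (k + 1), ← inv_pow]
    push_cast
    ring

theorem qInt_add {R : Type*} [CommRing R] (ξ : Rˣ) (a b : ℤ) :
    qInt ξ (a + b) = qInt ξ a + ((ξ ^ a : Rˣ) : R) * qInt ξ b := by
  induction b using Int.induction_on with
  | zero => simp [qInt_zero]
  | succ i ih =>
    rw [← add_assoc, qInt_succ, ih, qInt_succ, zpow_add]
    push_cast
    ring
  | pred i ih =>
    have h1 := qInt_succ ξ (a + (-(i : ℤ) - 1))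
    have h2 := qInt_succ ξ (-(i : ℤ) - 1)
    rw [show a + (-(i : ℤ) - 1) + 1 = a + -i by ring, ih, zpow_add] at h1
    rw [show (-(i : ℤ) - 1) + 1 = -i by ring] at h2
    rw [h2] at h1
    push_cast at h1
    linear_combination -h1

theorem zpow_eq_qInt {R : Type*} [CommRing R] (ξ : Rˣ) (k : ℤ) :
    ((ξ ^ k : Rˣ) : R) = 1 + ((ξ : R) - 1) * qInt ξ k := by
  have h1 := qInt_succ ξ k
  have h2 := qInt_add ξ 1 k
  have h3 := qInt_succ ξ 0
  simp only [qInt_zero, zpow_zero, zpow_one, Units.val_one, zero_add] at h2 h3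
  rw [add_comm 1 k] at h2
  linear_combination h2 - h1 + h3

theorem qInt_neg {R : Type*} [CommRing R] (ξ : Rˣ) (k : ℤ) :
    ((ξ ^ k : Rˣ) : R) * qInt ξ (-k) = -qInt ξ k := by
  have h := qInt_add ξ k (-k)
  rw [add_neg_cancel, qInt_zero] at h
  linear_combination -h

theorem qInt_one {R : Type*} [CommRing R] (ξ : Rˣ) : qInt ξ 1 = 1 := by
  have h3 := qInt_succ ξ 0
  simpa [qInt_zero] using h3

/-- The smaller entry `r` moved by the simple transposition `s_r`. -/
def lo {n : ℕ} (r : Fin (n - 1)) : Fin n := ⟨r, by omega⟩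

/-- The larger entry `r + 1` moved by the simple transposition `s_r`. -/
def hi {n : ℕ} (r : Fin (n - 1)) : Fin n := ⟨r + 1, by omega⟩

/-- Generators of the cyclotomic Hecke algebra; indices start at `0`. -/
inductive Gen (n : ℕ) : Type
  | L (k : Fin n) : Gen n
  | T (r : Fin (n - 1)) : Gen n

/-- The free generator `L_k`. -/
def freeL {R : Type*} [CommRing R] {n : ℕ} (k : Fin n) : FreeAlgebra R (Gen n) :=
  FreeAlgebra.ι R (Gen.L k)

/-- The free generator `T_r`. -/
def freeT {R : Type*} [CommRing R] {n : ℕ} (r : Fin (n - 1)) : FreeAlgebra R (Gen n) :=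
  FreeAlgebra.ι R (Gen.T r)

/-- A scalar in the free algebra. -/
def freeC {R : Type*} [CommRing R] {n : ℕ} (c : R) : FreeAlgebra R (Gen n) :=
  algebraMap R (FreeAlgebra R (Gen n)) c

/-- Defining relations of the cyclotomic Hecke algebra of degree `n`, with Hecke parameter `ξ`
and multicharge `κ`. -/
inductive Rel {R : Type*} [CommRing R] (ξ : Rˣ) {ℓ : ℕ} (κ : Fin ℓ → ℤ) (n : ℕ) :
    FreeAlgebra R (Gen n) → FreeAlgebra R (Gen n) → Prop
  | cyclotomic (h : 0 < n) :
      Rel ξ κ n (List.ofFn fun i => freeL ⟨0, h⟩ - freeC (qInt ξ (κ i))).prod 0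
  | quadratic (r : Fin (n - 1)) :
      Rel ξ κ n ((freeT r + 1) * (freeT r - freeC (ξ : R))) 0
  | L_comm (k m : Fin n) :
      Rel ξ κ n (freeL k * freeL m) (freeL m * freeL k)
  | T_comm (r s : Fin (n - 1)) (h : (r : ℕ) + 1 < s ∨ (s : ℕ) + 1 < r) :
      Rel ξ κ n (freeT r * freeT s) (freeT s * freeT r)
  | T_braid (r s : Fin (n - 1)) (h : (r : ℕ) + 1 = s) :
      Rel ξ κ n (freeT r * freeT s * freeT r) (freeT s * freeT r * freeT s)
  | T_L_comm (r : Fin (n - 1)) (k : Fin n) (h₁ : k ≠ lo r) (h₂ : k ≠ hi r) :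
      Rel ξ κ n (freeT r * freeL k) (freeL k * freeT r)
  | L_succ (r : Fin (n - 1)) :
      Rel ξ κ n (freeL (hi r) * (freeT r - freeC (ξ : R) + 1)) (freeT r * freeL (lo r) + 1)

/-- The cyclotomic Hecke algebra `H_{n,ℓ}(R, ξ, κ)`. -/
def Hecke {R : Type*} [CommRing R] (ξ : Rˣ) {ℓ : ℕ} (κ : Fin ℓ → ℤ) (n : ℕ) : Type _ :=
  RingQuot (Rel ξ κ n)

instance {R : Type*} [CommRing R] (ξ : Rˣ) {ℓ : ℕ} (κ : Fin ℓ → ℤ) (n : ℕ) :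
    Ring (Hecke ξ κ n) := inferInstanceAs (Ring (RingQuot (Rel ξ κ n)))

instance {R : Type*} [CommRing R] (ξ : Rˣ) {ℓ : ℕ} (κ : Fin ℓ → ℤ) (n : ℕ) :
    Algebra R (Hecke ξ κ n) := inferInstanceAs (Algebra R (RingQuot (Rel ξ κ n)))

/-- The quotient map from the free algebra. -/
def toHecke {R : Type*} [CommRing R] (ξ : Rˣ) {ℓ : ℕ} (κ : Fin ℓ → ℤ) (n : ℕ) :
    FreeAlgebra R (Gen n) →ₐ[R] Hecke ξ κ n := RingQuot.mkAlgHom R (Rel ξ κ n)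

/-- The Jucys-Murphy element `L_k`. -/
def heckeL {R : Type*} [CommRing R] (ξ : Rˣ) {ℓ : ℕ} (κ : Fin ℓ → ℤ) {n : ℕ} (k : Fin n) :
    Hecke ξ κ n := toHecke ξ κ n (freeL k)

/-- The generator `T_r`. -/
def heckeT {R : Type*} [CommRing R] (ξ : Rˣ) {ℓ : ℕ} (κ : Fin ℓ → ℤ) {n : ℕ}
    (r : Fin (n - 1)) : Hecke ξ κ n := toHecke ξ κ n (freeT r)

theorem toHecke_rel {R : Type*} [CommRing R] (ξ : Rˣ) {ℓ : ℕ} (κ : Fin ℓ → ℤ) (n : ℕ)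
    {x y : FreeAlgebra R (Gen n)} (h : Rel ξ κ n x y) : toHecke ξ κ n x = toHecke ξ κ n y :=
  RingQuot.mkAlgHom_rel R h

/-- The universal property of the presentation. -/
def Hecke.lift {R : Type*} [CommRing R] (ξ : Rˣ) {ℓ : ℕ} (κ : Fin ℓ → ℤ) (n : ℕ)
    {A : Type*} [Ring A] [Algebra R A] (L : Fin n → A) (T : Fin (n - 1) → A)
    (h_cyc : ∀ h : 0 < n,
      (List.ofFn fun i => L ⟨0, h⟩ - algebraMap R A (qInt ξ (κ i))).prod = 0)
    (h_quad : ∀ r, (T r + 1) * (T r - algebraMap R A (ξ : R)) = 0)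
    (h_LL : ∀ k m, L k * L m = L m * L k)
    (h_TT : ∀ r s : Fin (n - 1), ((r : ℕ) + 1 < s ∨ (s : ℕ) + 1 < r) → T r * T s = T s * T r)
    (h_braid : ∀ r s : Fin (n - 1), (r : ℕ) + 1 = s → T r * T s * T r = T s * T r * T s)
    (h_TL : ∀ (r : Fin (n - 1)) (k : Fin n), k ≠ lo r → k ≠ hi r → T r * L k = L k * T r)
    (h_succ : ∀ r, L (hi r) * (T r - algebraMap R A (ξ : R) + 1) = T r * L (lo r) + 1) :
    Hecke ξ κ n →ₐ[R] A :=
  RingQuot.liftAlgHom R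
    ⟨FreeAlgebra.lift R (fun g => match g with | Gen.L k => L k | Gen.T r => T r), by
      intro x y h
      cases h with
      | cyclotomic h =>
        have := h_cyc h
        rw [map_list_prod, List.map_ofFn]
        simpa [freeL, freeC, Function.comp_def] using this
      | quadratic r => simpa [freeT, freeC] using h_quad r
      | L_comm k m => simpa [freeL] using h_LL k m
      | T_comm r s h => simpa [freeT] using h_TT r s h
      | T_braid r s h => simpa [freeT] using h_braid r s h
      | T_L_comm r k h₁ h₂ => simpa [freeT, freeL] using h_TL r k h₁ h₂
      | L_succ r => simpa [freeT, freeL, freeC] using h_succ r⟩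

theorem Hecke.lift_heckeL {R : Type*} [CommRing R] (ξ : Rˣ) {ℓ : ℕ} (κ : Fin ℓ → ℤ) (n : ℕ)
    {A : Type*} [Ring A] [Algebra R A] (L : Fin n → A) (T : Fin (n - 1) → A)
    (h₁ h₂ h₃ h₄ h₅ h₆ h₇) (k : Fin n) :
    Hecke.lift ξ κ n L T h₁ h₂ h₃ h₄ h₅ h₆ h₇ (heckeL ξ κ k) = L k := by
  unfold Hecke.lift heckeL toHecke
  erw [RingQuot.liftAlgHom_mkAlgHom_apply]
  simp [freeL]

theorem Hecke.lift_heckeT {R : Type*} [CommRing R] (ξ : Rˣ) {ℓ : ℕ} (κ : Fin ℓ → ℤ) (n : ℕ)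
    {A : Type*} [Ring A] [Algebra R A] (L : Fin n → A) (T : Fin (n - 1) → A)
    (h₁ h₂ h₃ h₄ h₅ h₆ h₇) (r : Fin (n - 1)) :
    Hecke.lift ξ κ n L T h₁ h₂ h₃ h₄ h₅ h₆ h₇ (heckeT ξ κ r) = T r := by
  unfold Hecke.lift heckeT toHecke
  erw [RingQuot.liftAlgHom_mkAlgHom_apply]
  simp [freeT]

section relations

variable {R : Type*} [CommRing R] (ξ : Rˣ) {ℓ : ℕ} (κ : Fin ℓ → ℤ) {n : ℕ}

theorem cyc_rel (h : 0 < n) :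
    (List.ofFn fun i => heckeL ξ κ (n := n) ⟨0, h⟩ -
      algebraMap R (Hecke ξ κ n) (qInt ξ (κ i))).prod = 0 := by
  have := toHecke_rel ξ κ n (Rel.cyclotomic h)
  rw [map_list_prod, List.map_ofFn] at this
  simpa [Function.comp_def, freeC, heckeL] using this

theorem quad_rel (r : Fin (n - 1)) :
    (heckeT ξ κ r + 1) * (heckeT ξ κ r - algebraMap R (Hecke ξ κ n) ξ) = 0 := by
  have := toHecke_rel ξ κ n (Rel.quadratic r)
  simpa [freeC, heckeT] using this

theorem LL_rel (k m : Fin n) :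
    heckeL ξ κ k * heckeL ξ κ m = heckeL ξ κ m * heckeL ξ κ k := by
  simpa [heckeL] using toHecke_rel ξ κ n (Rel.L_comm k m)

theorem TT_rel (r s : Fin (n - 1)) (h : (r : ℕ) + 1 < s ∨ (s : ℕ) + 1 < r) :
    heckeT ξ κ r * heckeT ξ κ s = heckeT ξ κ s * heckeT ξ κ r := by
  simpa [heckeT] using toHecke_rel ξ κ n (Rel.T_comm r s h)

theorem braid_rel (r s : Fin (n - 1)) (h : (r : ℕ) + 1 = s) :
    heckeT ξ κ r * heckeT ξ κ s * heckeT ξ κ r = heckeT ξ κ s * heckeT ξ κ r * heckeT ξ κ s := by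
  simpa [heckeT] using toHecke_rel ξ κ n (Rel.T_braid r s h)

theorem TL_rel (r : Fin (n - 1)) (k : Fin n) (h₁ : k ≠ lo r) (h₂ : k ≠ hi r) :
    heckeT ξ κ r * heckeL ξ κ k = heckeL ξ κ k * heckeT ξ κ r := by
  simpa [heckeT, heckeL] using toHecke_rel ξ κ n (Rel.T_L_comm r k h₁ h₂)

theorem succ_rel (r : Fin (n - 1)) :
    heckeL ξ κ (hi r) * (heckeT ξ κ r - algebraMap R (Hecke ξ κ n) ξ + 1) =
      heckeT ξ κ r * heckeL ξ κ (lo r) + 1 := by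
  simpa [heckeT, heckeL, freeC] using toHecke_rel ξ κ n (Rel.L_succ r)

end relations

/-- If `∏ (y - u i) = 0` with all `u i` invertible scalars then `y` is invertible. -/
theorem isUnit_of_prod_eq_zero {R A : Type*} [CommRing R] [Ring A] [Algebra R A] {ℓ : ℕ}
    (u : Fin ℓ → Rˣ) (y : A)
    (h : (List.ofFn fun i => y - algebraMap R A (u i)).prod = 0) : IsUnit y := by
  let p : Polynomial R := (List.ofFn fun i => Polynomial.X - Polynomial.C (u i : R)).prod
  have hp : Polynomial.aeval y p = 0 := by
    rw [← h]
    simp only [p, map_list_prod, List.map_ofFn, Function.comp_def, map_sub, Polynomial.aeval_X,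
      Polynomial.aeval_C]
  have h0 : IsUnit (p.coeff 0) := by
    rw [Polynomial.coeff_zero_eq_eval_zero]
    simp only [p, List.prod_ofFn, Polynomial.eval_prod, Polynomial.eval_sub, Polynomial.eval_X,
      Polynomial.eval_C, zero_sub]
    exact IsUnit.prod_univ_iff.2 fun i => (u i).isUnit.neg
  obtain ⟨c, hc⟩ := h0
  have key : y * Polynomial.aeval y p.divX = -algebraMap R A c := by
    have h1 := congrArg (Polynomial.aeval y) (Polynomial.X_mul_divX_add p)
    rw [hp, map_add, map_mul, Polynomial.aeval_X, Polynomial.aeval_C, ← hc] at h1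
    exact eq_neg_of_add_eq_zero_left h1
  have comm : Commute y (Polynomial.aeval y p.divX) := by
    have : Commute (Polynomial.aeval y (Polynomial.X : Polynomial R))
        (Polynomial.aeval y p.divX) := by
      unfold Commute SemiconjBy
      rw [← map_mul, ← map_mul, mul_comm]
    simpa using this
  have hu : IsUnit (y * Polynomial.aeval y p.divX) := by
    rw [key]
    exact (c.isUnit.map (algebraMap R A)).neg
  exact (comm.isUnit_mul_iff.1 hu).1

/-- The affine Jucys-Murphy element `(ξ - 1) L_k + 1`. -/
def affineL {R : Type*} [CommRing R] (ξ : Rˣ) {ℓ : ℕ} (κ : Fin ℓ → ℤ) {n : ℕ} (k : Fin n) :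
    Hecke ξ κ n := algebraMap R (Hecke ξ κ n) (ξ - 1) * heckeL ξ κ k + 1

section affine

variable {R : Type*} [CommRing R] (ξ : Rˣ) {ℓ : ℕ} (κ : Fin ℓ → ℤ) {n : ℕ}

theorem heckeT_mul (r : Fin (n - 1)) :
    heckeT ξ κ r * (heckeT ξ κ r - algebraMap R (Hecke ξ κ n) ξ + 1) =
      algebraMap R (Hecke ξ κ n) ξ := by
  have h := quad_rel ξ κ r
  linear_combination (norm := noncomm_ring) h

theorem mul_heckeT (r : Fin (n - 1)) :
    (heckeT ξ κ r - algebraMap R (Hecke ξ κ n) ξ + 1) * heckeT ξ κ r =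
      algebraMap R (Hecke ξ κ n) ξ := by
  have h := quad_rel ξ κ r
  have hc := Algebra.commutes (ξ : R) (heckeT ξ κ r)
  linear_combination (norm := noncomm_ring) h - hc

theorem isUnit_heckeT (r : Fin (n - 1)) : IsUnit (heckeT ξ κ r) := by
  have hu : IsUnit (heckeT ξ κ r * (heckeT ξ κ r - algebraMap R (Hecke ξ κ n) ξ + 1)) := by
    rw [heckeT_mul]
    exact ξ.isUnit.map _
  have hc : Commute (heckeT ξ κ r) (heckeT ξ κ r - algebraMap R (Hecke ξ κ n) ξ + 1) := by
    unfold Commute SemiconjBy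
    rw [heckeT_mul, mul_heckeT]
  exact (hc.isUnit_mul_iff.1 hu).1

theorem heckeL_hi (r : Fin (n - 1)) :
    algebraMap R (Hecke ξ κ n) ξ * heckeL ξ κ (hi r) =
      heckeT ξ κ r * heckeL ξ κ (lo r) * heckeT ξ κ r + heckeT ξ κ r := by
  have h := succ_rel ξ κ r
  have hm := mul_heckeT ξ κ r
  have hc := Algebra.commutes (ξ : R) (heckeL ξ κ (hi r))
  linear_combination (norm := noncomm_ring) hc - heckeL ξ κ (hi r) * hm + h * heckeT ξ κ r

theorem affineL_hi (r : Fin (n - 1)) :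
    algebraMap R (Hecke ξ κ n) ξ * affineL ξ κ (hi r) =
      heckeT ξ κ r * affineL ξ κ (lo r) * heckeT ξ κ r := by
  have h := heckeL_hi ξ κ r
  have hm := mul_heckeT ξ κ r
  have hc := Algebra.commutes (ξ : R) (heckeT ξ κ r)
  unfold affineL
  rw [map_sub, map_one]
  linear_combination (norm := noncomm_ring) (algebraMap R (Hecke ξ κ n) ξ - 1) * h - hm +
    hc * (heckeL ξ κ (lo r) * heckeT ξ κ r)

theorem isUnit_affineL (k : Fin n) : IsUnit (affineL ξ κ k) := by
  obtain ⟨k, hk⟩ := k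
  induction k with
  | zero =>
    apply isUnit_of_prod_eq_zero (fun i => ξ ^ κ i)
    have : (fun i => affineL ξ κ (⟨0, hk⟩ : Fin n) -
        algebraMap R (Hecke ξ κ n) ((ξ ^ κ i : Rˣ) : R)) =
        fun i => algebraMap R (Hecke ξ κ n) (ξ - 1) *
          (heckeL ξ κ (n := n) ⟨0, hk⟩ - algebraMap R (Hecke ξ κ n) (qInt ξ (κ i))) := by
      funext i
      rw [zpow_eq_qInt, affineL, map_add, map_one, map_mul, mul_sub]
      abel
    rw [this]
    rcases ℓ with _ | ℓ
    · simpa using cyc_rel ξ κ hk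
    · have key : ∀ (m : ℕ) (f : Fin m → Hecke ξ κ n) (c : R),
          (List.ofFn fun i => algebraMap R (Hecke ξ κ n) c * f i).prod =
            algebraMap R (Hecke ξ κ n) (c ^ m) * (List.ofFn f).prod := by
        intro m
        induction m with
        | zero => simp
        | succ m ih =>
          intro f c
          rw [List.ofFn_succ, List.prod_cons, ih, List.ofFn_succ, List.prod_cons, pow_succ']
          simp only [← Algebra.smul_def, smul_mul_assoc, mul_smul_comm, smul_smul, mul_comm c]
      rw [key, cyc_rel, mul_zero]
  | succ k ih =>
    have h := affineL_hi ξ κ (⟨k, by omega⟩ : Fin (n - 1))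
    have h1 : IsUnit (affineL ξ κ (lo (⟨k, by omega⟩ : Fin (n - 1)))) := ih (by omega)
    have h2 := ((isUnit_heckeT ξ κ (⟨k, by omega⟩ : Fin (n - 1))).mul h1).mul
      (isUnit_heckeT ξ κ (⟨k, by omega⟩ : Fin (n - 1)))
    rw [← h] at h2
    exact ((Commute.isUnit_mul_iff (Algebra.commutes _ _)).1 h2).2

end affine

/-- The multicharge `κ' = (-κ_ℓ, …, -κ_1)`. -/
def conjCharge {ℓ : ℕ} (κ : Fin ℓ → ℤ) : Fin ℓ → ℤ := fun i => -κ i.rev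

/-- The image `-ξ T_r⁻¹` of `T_r` under the hash map. -/
def hashT {R : Type*} [CommRing R] (ξ : Rˣ) {ℓ : ℕ} (κ : Fin ℓ → ℤ) {n : ℕ}
    (r : Fin (n - 1)) : Hecke ξ κ n :=
  -(algebraMap R (Hecke ξ κ n) ξ * Ring.inverse (heckeT ξ κ r))

/-- The image of `L_k` under the hash map: `-L_k` if `ξ = 1`, and in general the element for which
`(ξ - 1) L_k + 1` is sent to its inverse. -/
def hashL {R : Type*} [CommRing R] (ξ : Rˣ) {ℓ : ℕ} (κ : Fin ℓ → ℤ) {n : ℕ}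
    (k : Fin n) : Hecke ξ κ n :=
  -(heckeL ξ κ k * Ring.inverse (affineL ξ κ k))

section hash

variable {R : Type*} [CommRing R] (ξ : Rˣ) {ℓ : ℕ} (κ : Fin ℓ → ℤ) {n : ℕ}

theorem hashT_eq (r : Fin (n - 1)) :
    hashT ξ κ r = algebraMap R (Hecke ξ κ n) ξ - 1 - heckeT ξ κ r := by
  unfold hashT
  have h := Ring.mul_inverse_cancel _ (isUnit_heckeT ξ κ r)
  have hm := mul_heckeT ξ κ r
  linear_combination (norm := noncomm_ring) hm * Ring.inverse (heckeT ξ κ r) -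
    (heckeT ξ κ r - algebraMap R (Hecke ξ κ n) ξ + 1) * h

theorem commute_inverse {A : Type*} [Ring A] {a b : A} (hb : IsUnit b) (hab : a * b = b * a) :
    a * Ring.inverse b = Ring.inverse b * a := by
  have h1 := Ring.mul_inverse_cancel _ hb
  have h2 := Ring.inverse_mul_cancel _ hb
  linear_combination (norm := noncomm_ring) Ring.inverse b * a * h1 -
    h2 * (a * Ring.inverse b) - Ring.inverse b * hab * Ring.inverse b

theorem heckeL_affineL (k m : Fin n) :
    heckeL ξ κ k * affineL ξ κ m = affineL ξ κ m * heckeL ξ κ k := by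
  have h := LL_rel ξ κ k m
  have hc := Algebra.commutes ((ξ : R) - 1) (heckeL ξ κ k)
  unfold affineL
  linear_combination (norm := noncomm_ring) algebraMap R (Hecke ξ κ n) (ξ - 1) * h -
    hc * heckeL ξ κ m

theorem affineL_affineL (k m : Fin n) :
    affineL ξ κ k * affineL ξ κ m = affineL ξ κ m * affineL ξ κ k := by
  have h := heckeL_affineL ξ κ k m
  have hc := Algebra.commutes ((ξ : R) - 1) (affineL ξ κ m)
  rw [affineL, add_mul, mul_assoc, h, ← mul_assoc, hc, mul_assoc]
  noncomm_ring

theorem heckeT_affineL (r : Fin (n - 1)) (k : Fin n) (h₁ : k ≠ lo r) (h₂ : k ≠ hi r) :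
    heckeT ξ κ r * affineL ξ κ k = affineL ξ κ k * heckeT ξ κ r := by
  have h := TL_rel ξ κ r k h₁ h₂
  have hc := Algebra.commutes ((ξ : R) - 1) (heckeT ξ κ r)
  unfold affineL
  linear_combination (norm := noncomm_ring) algebraMap R (Hecke ξ κ n) (ξ - 1) * h -
    hc * heckeL ξ κ k

theorem hashL_comm (k m : Fin n) :
    hashL ξ κ k * hashL ξ κ m = hashL ξ κ m * hashL ξ κ k := by
  have c1 : Commute (heckeL ξ κ k) (heckeL ξ κ m) := LL_rel ξ κ k m
  have c2 : Commute (heckeL ξ κ k) (Ring.inverse (affineL ξ κ m)) :=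
    commute_inverse (isUnit_affineL ξ κ m) (heckeL_affineL ξ κ k m)
  have c3 : Commute (heckeL ξ κ m) (Ring.inverse (affineL ξ κ k)) :=
    commute_inverse (isUnit_affineL ξ κ k) (heckeL_affineL ξ κ m k)
  have c4 : Commute (affineL ξ κ k) (affineL ξ κ m) := affineL_affineL ξ κ k m
  have c5 := c4.ringInverse_ringInverse
  exact (((c1.mul_right c2).mul_left (c3.symm.mul_right c5)).neg_left.neg_right).eq

theorem hashT_hashL (r : Fin (n - 1)) (k : Fin n) (h₁ : k ≠ lo r) (h₂ : k ≠ hi r) :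
    hashT ξ κ r * hashL ξ κ k = hashL ξ κ k * hashT ξ κ r := by
  have c1 : Commute (heckeT ξ κ r) (heckeL ξ κ k) := TL_rel ξ κ r k h₁ h₂
  have c2 : Commute (heckeT ξ κ r) (Ring.inverse (affineL ξ κ k)) :=
    commute_inverse (isUnit_affineL ξ κ k) (heckeT_affineL ξ κ r k h₁ h₂)
  rw [hashT_eq]
  have c3 : Commute (algebraMap R (Hecke ξ κ n) ξ - 1) (hashL ξ κ k) := by
    rw [← map_one (algebraMap R (Hecke ξ κ n)), ← map_sub]
    exact Algebra.commutes _ _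
  exact (c3.sub_left (c1.mul_right c2).neg_right).eq

theorem hashT_comm (r s : Fin (n - 1)) (h : (r : ℕ) + 1 < s ∨ (s : ℕ) + 1 < r) :
    hashT ξ κ r * hashT ξ κ s = hashT ξ κ s * hashT ξ κ r := by
  have c1 : Commute (heckeT ξ κ r) (heckeT ξ κ s) := TT_rel ξ κ r s h
  rw [hashT_eq, hashT_eq, ← map_one (algebraMap R (Hecke ξ κ n)), ← map_sub]
  have c : ∀ x : Hecke ξ κ n, Commute (algebraMap R (Hecke ξ κ n) (ξ - 1)) x :=
    fun x => Algebra.commutes _ _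
  exact ((c _).sub_left ((c _).symm.sub_right c1)).eq

theorem hashT_quad (r : Fin (n - 1)) :
    (hashT ξ κ r + 1) * (hashT ξ κ r - algebraMap R (Hecke ξ κ n) ξ) = 0 := by
  rw [hashT_eq]
  have h := quad_rel ξ κ r
  have hc := Algebra.commutes (ξ : R) (heckeT ξ κ r)
  linear_combination (norm := noncomm_ring) h - hc

theorem hashT_braid (r s : Fin (n - 1)) (h : (r : ℕ) + 1 = s) :
    hashT ξ κ r * hashT ξ κ s * hashT ξ κ r = hashT ξ κ s * hashT ξ κ r * hashT ξ κ s := by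
  have hb := braid_rel ξ κ r s h
  have hr := quad_rel ξ κ r
  have hs := quad_rel ξ κ s
  simp only [hashT_eq, Algebra.algebraMap_eq_smul_one, add_mul, mul_sub, sub_mul,
    smul_mul_assoc, mul_smul_comm, mul_one, one_mul, smul_sub, smul_add] at *
  linear_combination (norm := module) ((ξ : R) - 1) • hr - ((ξ : R) - 1) • hs - hb

theorem hash_succ (r : Fin (n - 1)) :
    hashL ξ κ (hi r) * (hashT ξ κ r - algebraMap R (Hecke ξ κ n) ξ + 1) =
      hashT ξ κ r * hashL ξ κ (lo r) + 1 := by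
  have hT := isUnit_heckeT ξ κ r
  have hY := isUnit_affineL ξ κ (lo r)
  have hY' := isUnit_affineL ξ κ (hi r)
  have hY1 := Ring.mul_inverse_cancel _ hY
  have key : Ring.inverse (affineL ξ κ (hi r)) * heckeT ξ κ r =
      algebraMap R (Hecke ξ κ n) ξ * (Ring.inverse (heckeT ξ κ r) *
        Ring.inverse (affineL ξ κ (lo r))) := by
    apply hY'.mul_left_cancel
    rw [Ring.mul_inverse_cancel_left _ _ hY', ← mul_assoc, ← Algebra.commutes, affineL_hi,
      mul_assoc (_ * _), Ring.mul_inverse_cancel_left _ _ hT, mul_assoc, hY1, mul_one]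
  have h1 : hashL ξ κ (hi r) * (hashT ξ κ r - algebraMap R (Hecke ξ κ n) ξ + 1) =
      heckeL ξ κ (hi r) * (Ring.inverse (affineL ξ κ (hi r)) * heckeT ξ κ r) := by
    rw [hashT_eq, hashL]
    noncomm_ring
  rw [h1, key, ← mul_assoc, ← Algebra.commutes, heckeL_hi, hashT_eq, hashL]
  have hT1 := Ring.mul_inverse_cancel _ hT
  have hd : affineL ξ κ (lo r) =
    (algebraMap R (Hecke ξ κ n) ξ - 1) * heckeL ξ κ (lo r) + 1 := by
    rw [affineL, map_sub, map_one]
  generalize Ring.inverse (affineL ξ κ (lo r)) = Yi at *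
  rw [hd] at hY1
  linear_combination (norm := noncomm_ring)
    (heckeT ξ κ r * heckeL ξ κ (lo r) + 1) * hT1 * Yi + hY1

theorem hash_cyc (κ' : Fin ℓ → ℤ) (hκ : κ' = conjCharge κ) (h : 0 < n) :
    (List.ofFn fun i => hashL ξ κ' (⟨0, h⟩ : Fin n) -
      algebraMap R (Hecke ξ κ' n) (qInt ξ (κ i))).prod = 0 := by
  have hc := cyc_rel ξ κ' h
  have hY := isUnit_affineL ξ κ' (⟨0, h⟩ : Fin n)
  have hY1 := Ring.mul_inverse_cancel _ hY
  have hY2 := Ring.inverse_mul_cancel _ hY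
  have hLY := commute_inverse hY (heckeL_affineL ξ κ' (⟨0, h⟩ : Fin n) ⟨0, h⟩)
  have hd : affineL ξ κ' (⟨0, h⟩ : Fin n) =
    ((ξ : R) - 1) • heckeL ξ κ' (⟨0, h⟩ : Fin n) + 1 := by
    rw [affineL, Algebra.smul_def]
  have hlin : ∀ k : ℤ, hashL ξ κ' (⟨0, h⟩ : Fin n) - algebraMap R (Hecke ξ κ' n) (qInt ξ k) =
      (-Ring.inverse (affineL ξ κ' (⟨0, h⟩ : Fin n)) *
        algebraMap R (Hecke ξ κ' n) ((ξ ^ k : Rˣ) : R)) *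
        (heckeL ξ κ' (⟨0, h⟩ : Fin n) - algebraMap R (Hecke ξ κ' n) (qInt ξ (-k))) := by
    intro k
    have e1 := zpow_eq_qInt ξ k
    have e2 := qInt_neg ξ k
    rw [hashL, hLY]
    generalize Ring.inverse (affineL ξ κ' (⟨0, h⟩ : Fin n)) = Yi at *
    rw [hd] at hY2
    simp only [Algebra.algebraMap_eq_smul_one, mul_add, mul_sub, sub_mul,
      smul_mul_assoc, mul_smul_comm, mul_one, one_mul, smul_smul] at *
    rw [mul_comm] at e2
    rw [e2, e1]
    linear_combination (norm := (simp only [neg_mul]; module)) (qInt ξ k) • hY2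
  have hYL : Commute (Ring.inverse (affineL ξ κ' (⟨0, h⟩ : Fin n)))
      (heckeL ξ κ' (⟨0, h⟩ : Fin n)) := hLY.symm
  have hprod : ∀ l : List ℤ,
      ∃ x : Hecke ξ κ' n, Commute x (heckeL ξ κ' (⟨0, h⟩ : Fin n)) ∧
        (l.map fun k => hashL ξ κ' (⟨0, h⟩ : Fin n) -
          algebraMap R (Hecke ξ κ' n) (qInt ξ k)).prod = x * ((l.map Neg.neg).map fun k =>
            heckeL ξ κ' (⟨0, h⟩ : Fin n) - algebraMap R (Hecke ξ κ' n) (qInt ξ k)).prod := by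
    intro l
    induction l with
    | nil => exact ⟨1, Commute.one_left _, by simp⟩
    | cons k l ih =>
      obtain ⟨x, hx, he⟩ := ih
      refine ⟨_, ((hYL.neg_left.mul_left (Algebra.commutes ((ξ ^ k : Rˣ) : R) _)).mul_left hx), ?_⟩
      simp only [List.map_cons, List.prod_cons]
      rw [he, hlin k]
      have hxk : Commute x (heckeL ξ κ' (⟨0, h⟩ : Fin n) -
          algebraMap R (Hecke ξ κ' n) (qInt ξ (-k))) :=
        hx.sub_right (Algebra.commutes _ _).symm
      simp only [mul_assoc]
      congr 2
      rw [← mul_assoc, ← hxk.eq, mul_assoc]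
  obtain ⟨x, -, hx⟩ := hprod (List.ofFn κ)
  rw [List.map_ofFn] at hx
  have hperm : (List.ofFn κ').Perm ((List.ofFn κ).map Neg.neg) := by
    rw [List.map_ofFn]
    have := Equiv.Perm.ofFn_comp_perm Fin.revPerm (Neg.neg ∘ κ)
    rw [hκ]
    exact this
  have hzero : (((List.ofFn κ).map Neg.neg).map fun k =>
      heckeL ξ κ' (⟨0, h⟩ : Fin n) - algebraMap R (Hecke ξ κ' n) (qInt ξ k)).prod = 0 := by
    rw [← hc, ← (hperm.map _).prod_eq' ?_, List.map_ofFn]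
    · rfl
    · refine List.pairwise_of_forall_mem_list ?_
      intro a ha b hb
      obtain ⟨k, -, rfl⟩ := List.mem_map.1 ha
      obtain ⟨m, -, rfl⟩ := List.mem_map.1 hb
      have c : ∀ (x : R) (y : Hecke ξ κ' n), Commute (algebraMap R (Hecke ξ κ' n) x) y :=
        fun x y => Algebra.commutes x y
      exact ((Commute.refl _).sub_right (c _ _).symm).sub_left (c _ _)
  rw [hzero, mul_zero] at hx
  exact hx

end hash

/-- The hash map `# : H_{n,ℓ}(R, ξ, κ) → H_{n,ℓ}(R, ξ, κ')`. -/
def hash {R : Type*} [CommRing R] (ξ : Rˣ) {ℓ : ℕ} (κ κ' : Fin ℓ → ℤ) (n : ℕ)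
    (hκ : κ' = conjCharge κ) : Hecke ξ κ n →ₐ[R] Hecke ξ κ' n :=
  Hecke.lift ξ κ n (hashL ξ κ') (hashT ξ κ') (hash_cyc ξ κ κ' hκ) (hashT_quad ξ κ')
    (hashL_comm ξ κ') (hashT_comm ξ κ') (hashT_braid ξ κ') (hashT_hashL ξ κ') (hash_succ ξ κ')

section hash

variable {R : Type*} [CommRing R] (ξ : Rˣ) {ℓ : ℕ} (κ κ' : Fin ℓ → ℤ) {n : ℕ}
  (hκ : κ' = conjCharge κ)

theorem hash_heckeT_mul (r : Fin (n - 1)) :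
    hash ξ κ κ' n hκ (heckeT ξ κ r) * heckeT ξ κ' r = -algebraMap R (Hecke ξ κ' n) ξ := by
  rw [hash, Hecke.lift_heckeT, hashT, neg_mul, mul_assoc,
    Ring.inverse_mul_cancel _ (isUnit_heckeT ξ κ' r), mul_one]

theorem hash_affineL_mul (k : Fin n) :
    hash ξ κ κ' n hκ (affineL ξ κ k) * affineL ξ κ' k = 1 := by
  have h := Ring.inverse_mul_cancel _ (isUnit_affineL ξ κ' k)
  have hd : affineL ξ κ' k =
    algebraMap R (Hecke ξ κ' n) (ξ - 1) * heckeL ξ κ' k + 1 := rfl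
  rw [affineL, map_add, map_mul, map_one, AlgHom.commutes, hash, Hecke.lift_heckeL, hashL,
    commute_inverse (isUnit_affineL ξ κ' k) (heckeL_affineL ξ κ' k k)]
  generalize Ring.inverse (affineL ξ κ' k) = Yi at *
  have c := Algebra.commutes ((ξ : R) - 1) Yi
  rw [add_mul, mul_neg, neg_mul, mul_assoc, mul_assoc, heckeL_affineL, ← mul_assoc Yi, h, one_mul,
    one_mul, hd]
  noncomm_ring

theorem hash_heckeL_of_one (k : Fin n) (h : ξ = 1) :
    hash ξ κ κ' n hκ (heckeL ξ κ k) = -heckeL ξ κ' k := by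
  subst h
  rw [hash, Hecke.lift_heckeL, hashL, affineL]
  simp

end hash

/-- The alternating cyclotomic Hecke algebra: the elements fixed by the hash map, for a symmetric
multicharge. -/
def altHecke {R : Type*} [CommRing R] (ξ : Rˣ) {ℓ : ℕ} (κ : Fin ℓ → ℤ) (n : ℕ)
    (hκ : κ = conjCharge κ) : Subalgebra R (Hecke ξ κ n) :=
  AlgHom.equalizer (hash ξ κ κ n hκ) (AlgHom.id R (Hecke ξ κ n))

/-- An `ℓ`-multipartition of `n`, each component being given by its Young diagram. -/
@[ext]
structure Multipartition (ℓ n : ℕ) where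
  /-- The components. -/
  comp : Fin ℓ → YoungDiagram
  /-- The total size is `n`. -/
  sum_card : ∑ i, (comp i).card = n

/-- The conjugate multipartition: reverse the components and transpose each of them. -/
def Multipartition.conj {ℓ n : ℕ} (lam : Multipartition ℓ n) : Multipartition ℓ n where
  comp i := (lam.comp i.rev).transpose
  sum_card := by
    refine Eq.trans ?_ lam.sum_card
    rw [← Equiv.sum_comp Fin.revPerm fun i => (lam.comp i).card]
    refine Finset.sum_congr rfl fun i _ => ?_
    simp [YoungDiagram.card, YoungDiagram.transpose]

/-- The boxes `(l, row, column)` of a multipartition; rows and columns are numbered from `0`. -/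
def Box {ℓ n : ℕ} (lam : Multipartition ℓ n) : Type :=
  {b : Fin ℓ × ℕ × ℕ // b.2 ∈ lam.comp b.1}

/-- The component containing a box. -/
def Box.comp {ℓ n : ℕ} {lam : Multipartition ℓ n} (b : Box lam) : Fin ℓ := b.1.1

/-- The row of a box. -/
def Box.row {ℓ n : ℕ} {lam : Multipartition ℓ n} (b : Box lam) : ℕ := b.1.2.1

/-- The column of a box. -/
def Box.col {ℓ n : ℕ} {lam : Multipartition ℓ n} (b : Box lam) : ℕ := b.1.2.2

/-- A tableau: a bijective filling of the boxes with `n` consecutive numbers (from `0`). -/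
abbrev Tableau {ℓ n : ℕ} (lam : Multipartition ℓ n) : Type := Box lam ≃ Fin n

/-- Standard tableaux: entries increase along the rows and down the columns of each component. -/
structure IsStandard {ℓ n : ℕ} {lam : Multipartition ℓ n} (t : Tableau lam) : Prop where
  row_lt : ∀ b b' : Box lam, b.comp = b'.comp → b.row = b'.row → b.col < b'.col → t b < t b'
  col_lt : ∀ b b' : Box lam, b.comp = b'.comp → b.col = b'.col → b.row < b'.row → t b < t b'

/-- The set of standard tableaux of a given shape. -/
abbrev StdTableau {ℓ n : ℕ} (lam : Multipartition ℓ n) : Type :=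
  {t : Tableau lam // IsStandard t}

/-- The tableau `s_r · t`, in which the entries `r` and `r + 1` of `t` are exchanged. -/
def swapEntry {ℓ n : ℕ} {lam : Multipartition ℓ n} (r : Fin (n - 1)) (t : Tableau lam) :
    Tableau lam := t.trans (Equiv.swap (lo r) (hi r))

/-- The content `κ_l + column - row` of the entry `k` of `t`. -/
def content {ℓ n : ℕ} (κ : Fin ℓ → ℤ) {lam : Multipartition ℓ n} (t : Tableau lam)
    (k : Fin n) : ℤ :=
  κ (t.symm k).comp + ((t.symm k).col : ℤ) - ((t.symm k).row : ℤ)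

/-- The axial distance `ρ_r(t) = c_r(t) - c_{r+1}(t)`. -/
def axial {ℓ n : ℕ} (κ : Fin ℓ → ℤ) {lam : Multipartition ℓ n} (r : Fin (n - 1))
    (t : Tableau lam) : ℤ := content κ t (lo r) - content κ t (hi r)

/-- The semisimplicity parameter `P_H`. -/
def semisimpleParam {R : Type*} [CommRing R] (ξ : Rˣ) {ℓ : ℕ} (κ : Fin ℓ → ℤ) (n : ℕ) : R :=
  (∏ k ∈ Finset.Icc 1 n, qInt ξ (k : ℤ)) *
    ∏ p : Fin ℓ × Fin ℓ with p.1 < p.2, ∏ d ∈ Finset.Ioo (-(n : ℤ)) (n : ℤ),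
      qInt ξ (κ p.1 + d - κ p.2)

open Classical in
/-- Extension by zero, from standard tableaux to all tableaux. -/
def extendZero {ℓ n : ℕ} {lam : Multipartition ℓ n} {K : Type*} [Zero K]
    (f : StdTableau lam → K) (t : Tableau lam) : K :=
  if h : IsStandard t then f ⟨t, h⟩ else 0

/-- A (`*`-)seminormal coefficient system over a field. A coefficient attached to a tableau that
is not standard is read as `0`. -/
structure SeminormalSystem {K : Type*} [Field K] (ξ : Kˣ) {ℓ : ℕ} (κ : Fin ℓ → ℤ) (n : ℕ) where
  /-- The scalar `α_r(t)`. -/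
  coeff : ∀ {lam : Multipartition ℓ n}, Fin (n - 1) → StdTableau lam → K
  comm : ∀ {lam : Multipartition ℓ n} (t : StdTableau lam) (k m : Fin (n - 1)),
    ((k : ℕ) + 1 < m ∨ (m : ℕ) + 1 < k) →
    coeff k t * extendZero (coeff m) (swapEntry k t.1) =
      coeff m t * extendZero (coeff k) (swapEntry m t.1)
  braid : ∀ {lam : Multipartition ℓ n} (t : StdTableau lam) (r s : Fin (n - 1)),
    (r : ℕ) + 1 = s →
    extendZero (coeff r) (swapEntry s (swapEntry r t.1)) *
        extendZero (coeff s) (swapEntry r t.1) * coeff r t =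
      extendZero (coeff s) (swapEntry r (swapEntry s t.1)) *
        extendZero (coeff r) (swapEntry s t.1) * coeff s t
  not_standard : ∀ {lam : Multipartition ℓ n} (t : StdTableau lam) (r : Fin (n - 1)),
    ¬ IsStandard (swapEntry r t.1) → coeff r t = 0
  mul_swap : ∀ {lam : Multipartition ℓ n} (t v : StdTableau lam) (r : Fin (n - 1)),
    v.1 = swapEntry r t.1 →
    coeff r t * coeff r v =
      qInt ξ (1 + axial κ r t.1) * qInt ξ (1 + axial κ r v.1) /
        (qInt ξ (axial κ r t.1) * qInt ξ (axial κ r v.1))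

/-- The basis vector `f_t` if `t` is standard, and `0` otherwise. -/
def stdVec (K : Type*) [Field K] {ℓ n : ℕ} {lam : Multipartition ℓ n} (t : Tableau lam) :
    StdTableau lam →₀ K := extendZero (fun s => Finsupp.single s 1) t

/-- The operator `L_k f_t = [c_k(t)] f_t`. -/
def opL {K : Type*} [Field K] (ξ : Kˣ) {ℓ : ℕ} (κ : Fin ℓ → ℤ) {n : ℕ}
    (lam : Multipartition ℓ n) (k : Fin n) : Module.End K (StdTableau lam →₀ K) :=
  Finsupp.linearCombination K fun t : StdTableau lam => qInt ξ (content κ t.1 k) • stdVec K t.1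

/-- The operator `T_r f_t = α_r(t) f_{s_r t} - [ρ_r(t)]⁻¹ f_t`. -/
def opT {K : Type*} [Field K] {ξ : Kˣ} {ℓ : ℕ} {κ : Fin ℓ → ℤ} {n : ℕ}
    (α : SeminormalSystem ξ κ n) (lam : Multipartition ℓ n) (r : Fin (n - 1)) :
    Module.End K (StdTableau lam →₀ K) :=
  Finsupp.linearCombination K fun t : StdTableau lam =>
    α.coeff r t • stdVec K (swapEntry r t.1) - (qInt ξ (axial κ r t.1))⁻¹ • stdVec K t.1

section combinatorics

variable {ℓ n : ℕ} {lam : Multipartition ℓ n} {t : Tableau lam}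

theorem Box.ext' {b b' : Box lam} (h₁ : b.comp = b'.comp) (h₂ : b.row = b'.row)
    (h₃ : b.col = b'.col) : b = b' :=
  Subtype.ext (Prod.ext h₁ (Prod.ext h₂ h₃))

theorem Box.exists_le (b : Box lam) {i j : ℕ} (hi : i ≤ b.row) (hj : j ≤ b.col) :
    ∃ b' : Box lam, b'.comp = b.comp ∧ b'.row = i ∧ b'.col = j :=
  ⟨⟨(b.comp, i, j), (lam.comp b.comp).up_left_mem hi hj b.2⟩, rfl, rfl, rfl⟩

theorem IsStandard.le (ht : IsStandard t) {b b' : Box lam} (h : b.comp = b'.comp)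
    (h₁ : b.row ≤ b'.row) (h₂ : b.col ≤ b'.col) : t b ≤ t b' := by
  obtain ⟨c, hc, hc1, hc2⟩ := b'.exists_le h₁ le_rfl
  have e1 : t b ≤ t c := by
    rcases h₂.lt_or_eq with h₂ | h₂
    · exact (ht.row_lt b c (by rw [h, hc]) hc1.symm (by omega)).le
    · rw [Box.ext' (b := b) (b' := c) (by rw [h, hc]) hc1.symm (by omega)]
  have e2 : t c ≤ t b' := by
    rcases h₁.lt_or_eq with h₁ | h₁
    · exact (ht.col_lt c b' hc hc2 (by omega)).le
    · rw [Box.ext' (b := c) (b' := b') hc (by omega) (by omega)]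
  exact e1.trans e2

/-- Two boxes of one component with consecutive entries that are weakly comparable are
adjacent. -/
theorem IsStandard.adjacent (ht : IsStandard t) {b b' : Box lam} (h : b.comp = b'.comp)
    (h₁ : b.row ≤ b'.row) (h₂ : b.col ≤ b'.col) (hs : (t b : ℕ) + 1 = t b') :
    (b.row = b'.row ∧ b.col + 1 = b'.col) ∨ (b.col = b'.col ∧ b.row + 1 = b'.row) := by
  have hne : b ≠ b' := by rintro rfl; omega
  have btw : ∀ c : Box lam, c.comp = b.comp → b.row ≤ c.row → b.col ≤ c.col →
      c.row ≤ b'.row → c.col ≤ b'.col → c = b ∨ c = b' := by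
    intro c hc i1 i2 i3 i4
    have e1 := ht.le hc.symm i1 i2
    have e2 := ht.le (hc.trans h) i3 i4
    rw [Fin.le_def] at e1 e2
    rcases (show (t c : ℕ) = t b ∨ (t c : ℕ) = t b' by omega) with e | e
    · exact Or.inl (t.injective (Fin.ext e))
    · exact Or.inr (t.injective (Fin.ext e))
  by_cases hcol : b.col < b'.col
  · obtain ⟨c, hc, hc1, hc2⟩ := b'.exists_le h₁ (show b.col + 1 ≤ b'.col from hcol)
    rcases btw c (hc.trans h.symm) (by omega) (by omega) (by omega) (by omega) with e | e
    · rw [e] at hc2; omega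
    · rw [e] at hc1 hc2; left; omega
  · have hr : b.row < b'.row := by
      rcases h₁.lt_or_eq with h | h'
      · exact h
      · exact absurd (Box.ext' h h' (by omega)) hne
    obtain ⟨c, hc, hc1, hc2⟩ := b'.exists_le (show b.row + 1 ≤ b'.row from hr) h₂
    rcases btw c (hc.trans h.symm) (by omega) (by omega) (by omega) (by omega) with e | e
    · rw [e] at hc1; omega
    · rw [e] at hc1 hc2; right; omega

theorem hook_bound (b b' : Box lam) (t : Tableau lam) : b.col + b'.row + 1 ≤ n := by
  have e1 : ∀ x : ℕ, ∃ c : Box lam, x ≤ b.col → c.comp = b.comp ∧ c.row = 0 ∧ c.col = x := by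
    intro x
    by_cases h : x ≤ b.col
    · obtain ⟨c, hc⟩ := b.exists_le (Nat.zero_le _) h
      exact ⟨c, fun _ => hc⟩
    · exact ⟨b, fun h' => absurd h' h⟩
  have e2 : ∀ x : ℕ, ∃ c : Box lam, x ≤ b'.row → c.comp = b'.comp ∧ c.row = x ∧ c.col = 0 := by
    intro x
    by_cases h : x ≤ b'.row
    · obtain ⟨c, hc⟩ := b'.exists_le h (Nat.zero_le _)
      exact ⟨c, fun _ => hc⟩
    · exact ⟨b', fun h' => absurd h' h⟩
  choose f hf using e1
  choose g hg using e2
  let F : Fin (b.col + b'.row + 1) → Fin n := fun x =>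
    if (x : ℕ) ≤ b.col then t (f x) else t (g (x - b.col))
  have hF : Function.Injective F := by
    intro x y hxy
    simp only [F] at hxy
    have hx := x.2
    have hy := y.2
    split_ifs at hxy with h1 h2 h2
    · have := t.injective hxy
      have a1 := hf x h1
      have a2 := hf y h2
      rw [this] at a1
      ext; omega
    · have := t.injective hxy
      have a1 := hf x h1
      have a2 := hg (y - b.col) (by omega)
      rw [this] at a1
      omega
    · have := t.injective hxy
      have a1 := hg (x - b.col) (by omega)
      have a2 := hf y h2
      rw [this] at a1
      omega
    · have := t.injective hxy
      have a1 := hg (x - b.col) (by omega)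
      have a2 := hg (y - b.col) (by omega)
      rw [this] at a1
      ext; omega
  simpa using Fintype.card_le_of_injective F hF

theorem symm_swapEntry (r : Fin (n - 1)) (t : Tableau lam) (k : Fin n) :
    (swapEntry r t).symm k = t.symm (Equiv.swap (lo r) (hi r) k) := by
  simp [swapEntry]

theorem swapEntry_swapEntry (r : Fin (n - 1)) (t : Tableau lam) :
    swapEntry r (swapEntry r t) = t := by
  ext b
  simp [swapEntry]

theorem lo_ne_hi (r : Fin (n - 1)) : lo r ≠ hi r := by
  intro h
  have := congrArg Fin.val h
  simp [lo, hi] at this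

variable (κ : Fin ℓ → ℤ)

theorem content_swapEntry (r : Fin (n - 1)) (t : Tableau lam) (k : Fin n) :
    content κ (swapEntry r t) k = content κ t (Equiv.swap (lo r) (hi r) k) := by
  simp only [content, symm_swapEntry]

theorem content_swap_lo (r : Fin (n - 1)) (t : Tableau lam) :
    content κ (swapEntry r t) (lo r) = content κ t (hi r) := by
  rw [content_swapEntry, Equiv.swap_apply_left]

theorem content_swap_hi (r : Fin (n - 1)) (t : Tableau lam) :
    content κ (swapEntry r t) (hi r) = content κ t (lo r) := by
  rw [content_swapEntry, Equiv.swap_apply_right]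

theorem content_swap_ne (r : Fin (n - 1)) (t : Tableau lam) {k : Fin n} (h₁ : k ≠ lo r)
    (h₂ : k ≠ hi r) : content κ (swapEntry r t) k = content κ t k := by
  rw [content_swapEntry, Equiv.swap_apply_of_ne_of_ne h₁ h₂]

theorem axial_swap (r : Fin (n - 1)) (t : Tableau lam) :
    axial κ r (swapEntry r t) = -axial κ r t := by
  rw [axial, axial, content_swap_lo, content_swap_hi]
  ring

/-- If exchanging `r` and `r + 1` destroys standardness then these entries are adjacent, in a row
or in a column. -/
theorem IsStandard.adjacent_of_not (ht : IsStandard t) {r : Fin (n - 1)}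
    (h : ¬ IsStandard (swapEntry r t)) :
    (t.symm (lo r)).comp = (t.symm (hi r)).comp ∧
      (((t.symm (lo r)).row = (t.symm (hi r)).row ∧
        (t.symm (lo r)).col + 1 = (t.symm (hi r)).col) ∨
      ((t.symm (lo r)).col = (t.symm (hi r)).col ∧
        (t.symm (lo r)).row + 1 = (t.symm (hi r)).row)) := by
  have key : ∀ b b' : Box lam, t b < t b' → ¬ (swapEntry r t b < swapEntry r t b') →
      b = t.symm (lo r) ∧ b' = t.symm (hi r) := by
    intro b b' h1 h2
    rw [Equiv.eq_symm_apply, Equiv.eq_symm_apply]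
    simp only [swapEntry, Equiv.trans_apply, Equiv.swap_apply_def] at h2
    split_ifs at h2 <;> simp_all [Fin.ext_iff, Fin.lt_def, lo, hi] <;> omega
  by_contra hcon
  have fin : ∀ b b' : Box lam, b.comp = b'.comp → b.row ≤ b'.row → b.col ≤ b'.col →
      t b < t b' → ¬ (swapEntry r t b < swapEntry r t b') → False := by
    intro b b' h1 h2 h3 h4 h5
    obtain ⟨rfl, rfl⟩ := key b b' h4 h5
    exact hcon (And.intro h1 (ht.adjacent h1 h2 h3 (by simp [lo, hi])))
  refine h ⟨fun b b' h1 h2 h3 => ?_, fun b b' h1 h2 h3 => ?_⟩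
  · by_contra hn
    exact fin b b' h1 h2.le h3.le (ht.row_lt b b' h1 h2 h3) hn
  · by_contra hn
    exact fin b b' h1 h3.le h2.le (ht.col_lt b b' h1 h2 h3) hn

theorem IsStandard.axial_of_not (ht : IsStandard t) {r : Fin (n - 1)}
    (h : ¬ IsStandard (swapEntry r t)) : axial κ r t = 1 ∨ axial κ r t = -1 := by
  obtain ⟨h1, h2⟩ := ht.adjacent_of_not h
  simp only [axial, content, h1]
  omega

/-- The combinatorial input for the braid relation. -/
theorem IsStandard.axial_eq_of_not (ht : IsStandard t) {r s : Fin (n - 1)} (hrs : (r : ℕ) + 1 = s)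
    (h₁ : ¬ IsStandard (swapEntry r t)) (h₂ : ¬ IsStandard (swapEntry s t)) :
    axial κ r t = axial κ s t := by
  obtain ⟨e1, e2⟩ := ht.adjacent_of_not h₁
  obtain ⟨e3, e4⟩ := ht.adjacent_of_not h₂
  have hmid : hi r = lo s := by simp [hi, lo, hrs]
  rw [← hmid] at e3 e4
  simp only [axial, content, ← hmid, e1, ← e3]
  have bad : ∀ c : Box lam, c.comp = (t.symm (lo r)).comp → c ≠ t.symm (lo r) →
      c ≠ t.symm (hi r) → c ≠ t.symm (hi s) →
      (t.symm (lo r)).row ≤ c.row → (t.symm (lo r)).col ≤ c.col →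
      c.row ≤ (t.symm (hi s)).row → c.col ≤ (t.symm (hi s)).col → False := by
    intro c hc n1 n2 n3 i1 i2 i3 i4
    have a1 := ht.le hc.symm i1 i2
    have a2 := ht.le (hc.trans (e1.trans e3)) i3 i4
    rw [Ne, Equiv.eq_symm_apply] at n1 n2 n3
    simp only [Equiv.apply_symm_apply, Fin.le_def, Fin.ext_iff, lo, hi] at *
    omega
  rcases e2 with ⟨a, b⟩ | ⟨a, b⟩ <;> rcases e4 with ⟨c, d⟩ | ⟨c, d⟩
  · omega
  · exfalso
    obtain ⟨x, x1, x2, x3⟩ := (t.symm (hi s)).exists_le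
      (i := (t.symm (hi s)).row) (j := (t.symm (lo r)).col) le_rfl (by omega)
    refine bad x (by rw [x1, ← e3, e1]) ?_ ?_ ?_ (by omega) (by omega) (by omega) (by omega) <;>
    · rintro rfl
      omega
  · exfalso
    obtain ⟨x, x1, x2, x3⟩ := (t.symm (hi s)).exists_le
      (i := (t.symm (lo r)).row) (j := (t.symm (hi s)).col) (by omega) le_rfl
    refine bad x (by rw [x1, ← e3, e1]) ?_ ?_ ?_ (by omega) (by omega) (by omega) (by omega) <;>
    · rintro rfl
      omega
  · omega

theorem qInt_ne_zero_of_abs {K : Type*} [Field K] {ξ : Kˣ} {κ : Fin ℓ → ℤ}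
    (hP : semisimpleParam ξ κ n ≠ 0) {k : ℤ} (hk : k ≠ 0) (hn : |k| ≤ n) : qInt ξ k ≠ 0 := by
  have hpos : ∀ m : ℕ, 0 < m → m ≤ n → qInt ξ (m : ℤ) ≠ 0 := by
    intro m h1 h2 h0
    exact hP (by
      unfold semisimpleParam
      rw [Finset.prod_eq_zero (Finset.mem_Icc.2 ⟨h1, h2⟩) h0, zero_mul])
  rw [abs_le] at hn
  have h := hpos k.natAbs (by omega) (by omega)
  rcases Int.natAbs_eq k with e | e
  · rwa [e]
  · intro h0
    have h1 := qInt_neg ξ k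
    rw [h0, neg_zero] at h1
    have h2 : qInt ξ (-k) = 0 := (mul_eq_zero.1 h1).resolve_left (Units.ne_zero _)
    exact h (by rwa [e, neg_neg] at h2)

theorem qInt_ne_zero_of_ne {K : Type*} [Field K] {ξ : Kˣ} {κ : Fin ℓ → ℤ}
    (hP : semisimpleParam ξ κ n ≠ 0) {i j : Fin ℓ} (hij : i ≠ j) {d : ℤ} (hd : |d| < n) :
    qInt ξ (κ i + d - κ j) ≠ 0 := by
  have hlt : ∀ (i j : Fin ℓ) (d : ℤ), i < j → |d| < n → qInt ξ (κ i + d - κ j) ≠ 0 := by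
    intro i j d h1 h2 h0
    refine hP ?_
    unfold semisimpleParam
    rw [Finset.prod_eq_zero (i := (i, j)) (by simpa using h1), mul_zero]
    exact Finset.prod_eq_zero (Finset.mem_Ioo.2 (abs_lt.1 h2)) h0
  rcases lt_or_gt_of_ne hij with h | h
  · exact hlt i j d h hd
  · intro h0
    have h1 := qInt_neg ξ (κ i + d - κ j)
    rw [h0, neg_zero] at h1
    have h2 := (mul_eq_zero.1 h1).resolve_left (Units.ne_zero _)
    refine hlt j i (-d) h (by rwa [abs_neg]) ?_
    rw [← h2]
    congr 1
    ring

/-- The denominators in the seminormal form do not vanish. -/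
theorem qInt_axial_ne_zero {K : Type*} [Field K] {ξ : Kˣ} {κ : Fin ℓ → ℤ}
    (hP : semisimpleParam ξ κ n ≠ 0) (ht : IsStandard t) (r : Fin (n - 1)) :
    qInt ξ (axial κ r t) ≠ 0 := by
  have b1 := hook_bound (t.symm (lo r)) (t.symm (hi r)) t
  have b2 := hook_bound (t.symm (hi r)) (t.symm (lo r)) t
  by_cases hc : (t.symm (lo r)).comp = (t.symm (hi r)).comp
  · refine qInt_ne_zero_of_abs hP ?_ ?_
    · intro h0
      simp only [axial, content, hc] at h0
      have hne : t.symm (lo r) ≠ t.symm (hi r) := fun h => lo_ne_hi r (t.symm.injective h)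
      rcases le_total (t.symm (lo r)).row (t.symm (hi r)).row with h | h
      · rcases ht.adjacent hc h (by omega) (by simp [lo, hi]) with h' | h' <;> omega
      · have := ht.le hc.symm h (by omega)
        simp [lo, hi, Fin.le_def] at this
    · simp only [axial, content, hc]
      rw [abs_le]
      omega
  · have := qInt_ne_zero_of_ne hP hc
      (d := ((t.symm (lo r)).col : ℤ) - (t.symm (lo r)).row -
        ((t.symm (hi r)).col - (t.symm (hi r)).row)) (by rw [abs_lt]; omega)
    convert this using 2
    simp only [axial, content]
    ring

end combinatorics

section specht

variable {K : Type*} [Field K] {ξ : Kˣ} {ℓ : ℕ} {κ : Fin ℓ → ℤ} {n : ℕ}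
  {lam : Multipartition ℓ n}

theorem stdVec_of_not {t : Tableau lam} (h : ¬ IsStandard t) : stdVec K t = 0 := by
  simp [stdVec, extendZero, h]

theorem stdVec_val (t : StdTableau lam) : stdVec K t.1 = Finsupp.single t 1 := by
  simp only [stdVec, extendZero, dif_pos t.2]

theorem opL_stdVec (t : Tableau lam) (k : Fin n) :
    opL ξ κ lam k (stdVec K t) = qInt ξ (content κ t k) • stdVec K t := by
  by_cases h : IsStandard t
  · have := stdVec_val (K := K) (⟨t, h⟩ : StdTableau lam)
    rw [this, opL, Finsupp.linearCombination_single, one_smul, this]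
  · rw [stdVec_of_not h, map_zero, smul_zero]

theorem opT_stdVec (α : SeminormalSystem ξ κ n) (t : Tableau lam) (r : Fin (n - 1)) :
    opT α lam r (stdVec K t) = extendZero (α.coeff r) t • stdVec K (swapEntry r t) -
      (qInt ξ (axial κ r t))⁻¹ • stdVec K t := by
  by_cases h : IsStandard t
  · have := stdVec_val (K := K) (⟨t, h⟩ : StdTableau lam)
    rw [this, opT, Finsupp.linearCombination_single, one_smul, this]
    simp only [extendZero, dif_pos h]
  · rw [stdVec_of_not h, map_zero, smul_zero]
    simp [extendZero, h]

theorem end_ext {f g : Module.End K (StdTableau lam →₀ K)}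
    (h : ∀ t : Tableau lam, IsStandard t → f (stdVec K t) = g (stdVec K t)) : f = g := by
  refine Finsupp.lhom_ext' fun t => LinearMap.ext_ring ?_
  have := h t.1 t.2
  rw [stdVec_val] at this
  exact this

theorem coeff_eq_zero (α : SeminormalSystem ξ κ n) (t : Tableau lam) (r : Fin (n - 1))
    (h : ¬ IsStandard (swapEntry r t)) : extendZero (α.coeff r) t = 0 := by
  by_cases ht : IsStandard t
  · simp only [extendZero, dif_pos ht]
    exact α.not_standard ⟨t, ht⟩ r h
  · simp [extendZero, ht]

/-- The norm relation, in a form that holds for every standard tableau. -/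
theorem coeff_mul_coeff (α : SeminormalSystem ξ κ n) (hP : semisimpleParam ξ κ n ≠ 0)
    {t : Tableau lam} (ht : IsStandard t) (r : Fin (n - 1)) :
    extendZero (α.coeff r) t * extendZero (α.coeff r) (swapEntry r t) *
      qInt ξ (axial κ r t) ^ 2 =
      -((1 + ξ * qInt ξ (axial κ r t)) * (1 - qInt ξ (axial κ r t))) := by
  have hx := qInt_axial_ne_zero hP ht r
  have e1 := qInt_neg ξ (axial κ r t)
  have e2 := zpow_eq_qInt ξ (axial κ r t)
  have e3 := qInt_add ξ 1 (axial κ r t)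
  have e4 := qInt_add ξ 1 (-axial κ r t)
  have hx1 : ((ξ ^ (axial κ r t) : Kˣ) : K) ≠ 0 := Units.ne_zero _
  rw [qInt_one, zpow_one] at e3 e4
  by_cases h : IsStandard (swapEntry r t)
  · have h1 := α.mul_swap ⟨t, ht⟩ ⟨_, h⟩ r rfl
    simp only [extendZero, dif_pos ht, dif_pos h]
    rw [h1]
    simp only [axial_swap, e3, e4]
    have e5 : qInt ξ (-axial κ r t) =
        -qInt ξ (axial κ r t) / ((ξ ^ (axial κ r t) : Kˣ) : K) := by
      rw [eq_div_iff hx1]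
      linear_combination e1
    rw [e5]
    generalize ((ξ ^ (axial κ r t) : Kˣ) : K) = y at *
    generalize qInt ξ (axial κ r t) = x at *
    field_simp
    linear_combination -(1 + ξ * x) * e2
  · rw [coeff_eq_zero α t r h, zero_mul, zero_mul]
    rcases ht.axial_of_not κ h with h' | h'
    · rw [h', qInt_one]
      ring
    · have e6 := qInt_neg ξ 1
      rw [qInt_one, zpow_one] at e6
      rw [h']
      linear_combination (1 - qInt ξ (-1)) * e6

theorem specht_quad (α : SeminormalSystem ξ κ n) (hP : semisimpleParam ξ κ n ≠ 0)
    (r : Fin (n - 1)) :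
    (opT α lam r + 1) * (opT α lam r - algebraMap K (Module.End K _) (ξ : K)) = 0 := by
  refine end_ext fun t ht => ?_
  have hx := qInt_axial_ne_zero hP ht r
  have e1 := qInt_neg ξ (axial κ r t)
  have e2 := zpow_eq_qInt ξ (axial κ r t)
  have hx1 : ((ξ ^ (axial κ r t) : Kˣ) : K) ≠ 0 := Units.ne_zero _
  have e5 : qInt ξ (-axial κ r t) =
      -qInt ξ (axial κ r t) / ((ξ ^ (axial κ r t) : Kˣ) : K) := by
    field_simp
    linear_combination e1
  have hm := coeff_mul_coeff α hP ht r
  simp only [Module.End.mul_apply, LinearMap.add_apply, LinearMap.sub_apply, Module.End.one_apply,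
    Module.algebraMap_end_apply, opT_stdVec, map_sub, map_smul, LinearMap.zero_apply,
    swapEntry_swapEntry, axial_swap]
  rw [e5]
  rw [e2] at hx1 ⊢
  generalize qInt ξ (axial κ r t) = x at *
  generalize extendZero (α.coeff r) t = a at *
  generalize extendZero (α.coeff r) (swapEntry r t) = b at *
  have hab : a * b = -((1 + ξ * x) * (1 - x)) / x ^ 2 := by
    field_simp
    linear_combination hm
  have c1 : a * (-(-x / (1 + ((ξ : K) - 1) * x))⁻¹) - x⁻¹ * a + a - ξ * a = 0 := by
    field_simp
    ring
  have c2 : a * b + x⁻¹ * x⁻¹ - x⁻¹ + ξ * x⁻¹ - ξ = 0 := by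
    rw [hab]
    field_simp
    ring
  linear_combination (norm := module) c1 • stdVec K (swapEntry r t) + c2 • stdVec K t

theorem specht_LL (k m : Fin n) :
    opL ξ κ lam k * opL ξ κ lam m = opL ξ κ lam m * opL ξ κ lam k := by
  refine end_ext fun t ht => ?_
  simp only [Module.End.mul_apply, opL_stdVec, map_smul]
  rw [smul_comm]

theorem specht_TL (α : SeminormalSystem ξ κ n) (r : Fin (n - 1)) (k : Fin n) (h₁ : k ≠ lo r)
    (h₂ : k ≠ hi r) : opT α lam r * opL ξ κ lam k = opL ξ κ lam k * opT α lam r := by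
  refine end_ext fun t ht => ?_
  simp only [Module.End.mul_apply, opL_stdVec, opT_stdVec, map_smul, map_sub,
    content_swap_ne κ r t h₁ h₂]
  module

theorem specht_succ (α : SeminormalSystem ξ κ n) (hP : semisimpleParam ξ κ n ≠ 0)
    (r : Fin (n - 1)) :
    opL ξ κ lam (hi r) * (opT α lam r - algebraMap K (Module.End K _) (ξ : K) + 1) =
      opT α lam r * opL ξ κ lam (lo r) + 1 := by
  refine end_ext fun t ht => ?_
  have hx := qInt_axial_ne_zero hP ht r
  simp only [Module.End.mul_apply, LinearMap.add_apply, LinearMap.sub_apply, Module.End.one_apply,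
    Module.algebraMap_end_apply, opT_stdVec, opL_stdVec, map_sub, map_smul, map_add,
    content_swap_hi]
  have e1 := qInt_add ξ (content κ t (hi r)) (axial κ r t)
  have e2 := zpow_eq_qInt ξ (content κ t (hi r))
  rw [show content κ t (hi r) + axial κ r t = content κ t (lo r) by rw [axial]; ring] at e1
  rw [e1, e2]
  generalize qInt ξ (axial κ r t) = x at *
  generalize qInt ξ (content κ t (hi r)) = c at *
  have c1 : -(x⁻¹ * c) - ξ * c + c + (c + (1 + ((ξ : K) - 1) * c) * x) * x⁻¹ - 1 = 0 := by
    field_simp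
    ring
  linear_combination (norm := module) c1 • stdVec K t

theorem specht_cyc (h : 0 < n) :
    (List.ofFn fun i => opL ξ κ lam ⟨0, h⟩ -
      algebraMap K (Module.End K _) (qInt ξ (κ i))).prod = 0 := by
  refine end_ext fun t ht => ?_
  have key : ∀ l : List ℤ, (l.map fun k => opL ξ κ lam ⟨0, h⟩ -
      algebraMap K (Module.End K (StdTableau lam →₀ K)) (qInt ξ k)).prod (stdVec K t) =
      (l.map fun k => qInt ξ (content κ t ⟨0, h⟩) - qInt ξ k).prod • stdVec K t := by
    intro l
    induction l with
    | nil => simp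
    | cons k l ih =>
      simp only [List.map_cons, List.prod_cons, Module.End.mul_apply, ih, map_smul,
        LinearMap.sub_apply, opL_stdVec, Module.algebraMap_end_apply]
      module
  have h1 := key (List.ofFn κ)
  rw [List.map_ofFn, List.map_ofFn] at h1
  refine Eq.trans h1 ?_
  have hcont : content κ t ⟨0, h⟩ = κ (t.symm ⟨0, h⟩).comp := by
    obtain ⟨c, c1, c2, c3⟩ := (t.symm ⟨0, h⟩).exists_le (Nat.zero_le _) (Nat.zero_le _)
    have h2 := ht.le c1 (by omega) (by omega)
    rw [Equiv.apply_symm_apply, Fin.le_def] at h2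
    have h3 : t c = ⟨0, h⟩ := Fin.ext (by simpa using h2)
    rw [content, ← h3, Equiv.symm_apply_apply]
    omega
  rw [List.prod_ofFn, Finset.prod_eq_zero (Finset.mem_univ (t.symm ⟨0, h⟩).comp) (by simp [hcont]),
    zero_smul, LinearMap.zero_apply]

theorem swap_far {r s : Fin (n - 1)} (h : (r : ℕ) + 1 < s ∨ (s : ℕ) + 1 < r) :
    (lo s ≠ lo r ∧ lo s ≠ hi r) ∧ hi s ≠ lo r ∧ hi s ≠ hi r := by
  simp only [lo, hi, ne_eq, Fin.mk.injEq]
  omega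

theorem axial_far (κ : Fin ℓ → ℤ) (t : Tableau lam) {r s : Fin (n - 1)}
    (h : (r : ℕ) + 1 < s ∨ (s : ℕ) + 1 < r) : axial κ s (swapEntry r t) = axial κ s t := by
  have h' := swap_far h
  rw [axial, axial, content_swap_ne κ r t h'.1.1 h'.1.2, content_swap_ne κ r t h'.2.1 h'.2.2]

theorem swap_val (r : Fin (n - 1)) (x : Fin n) :
    (Equiv.swap (lo r) (hi r) x : ℕ) =
      if (x : ℕ) = r then (r : ℕ) + 1 else if (x : ℕ) = r + 1 then (r : ℕ) else x := by
  rw [Equiv.swap_apply_def]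
  simp only [Fin.ext_iff, lo, hi]
  split_ifs <;> rfl

theorem swapEntry_far (t : Tableau lam) {r s : Fin (n - 1)}
    (h : (r : ℕ) + 1 < s ∨ (s : ℕ) + 1 < r) :
    swapEntry r (swapEntry s t) = swapEntry s (swapEntry r t) := by
  ext b
  simp only [swapEntry, Equiv.trans_apply, swap_val]
  split_ifs <;> omega

theorem swapEntry_braid (t : Tableau lam) {r s : Fin (n - 1)} (h : (r : ℕ) + 1 = s) :
    swapEntry r (swapEntry s (swapEntry r t)) = swapEntry s (swapEntry r (swapEntry s t)) := by
  have hmid : hi r = lo s := by simp [hi, lo, h]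
  have n1 : lo r ≠ hi s := by simp [lo, hi, Fin.ext_iff]; omega
  have e1 := Equiv.swap_mul_swap_mul_swap (lo_ne_hi r) n1
  have e2 := Equiv.swap_mul_swap_mul_swap (lo_ne_hi s).symm n1.symm
  have e3 : Equiv.swap (lo r) (hi r) * Equiv.swap (lo s) (hi s) * Equiv.swap (lo r) (hi r) =
      Equiv.swap (lo s) (hi s) * Equiv.swap (lo r) (hi r) * Equiv.swap (lo s) (hi s) := by
    rw [hmid] at e1 ⊢
    rw [e1, Equiv.swap_comm (hi s), ← e2, Equiv.swap_comm (lo r), Equiv.swap_comm (lo s) (hi s)]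
  ext b
  exact congrArg Fin.val (Equiv.congr_fun e3 (t b))

theorem specht_TT (α : SeminormalSystem ξ κ n) (r s : Fin (n - 1))
    (h : (r : ℕ) + 1 < s ∨ (s : ℕ) + 1 < r) :
    opT α lam r * opT α lam s = opT α lam s * opT α lam r := by
  refine end_ext fun t ht => ?_
  have hc := α.comm ⟨t, ht⟩ r s h
  have e1 : ∀ r, extendZero (α.coeff r) t = α.coeff r ⟨t, ht⟩ := fun r => by
    simp only [extendZero, dif_pos ht]
  simp only [← e1] at hc
  simp only [Module.End.mul_apply, opT_stdVec, map_sub, map_smul, axial_far κ t h,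
    axial_far κ t h.symm, swapEntry_far t h]
  linear_combination (norm := module) -hc • stdVec K (swapEntry s (swapEntry r t))

theorem specht_braid (α : SeminormalSystem ξ κ n) (hP : semisimpleParam ξ κ n ≠ 0)
    (r s : Fin (n - 1)) (h : (r : ℕ) + 1 = s) :
    opT α lam r * opT α lam s * opT α lam r = opT α lam s * opT α lam r * opT α lam s := by
  refine end_ext fun t ht => ?_
  have hmid : hi r = lo s := by simp [hi, lo, h]
  have n1 : lo r ≠ lo s := by simp [lo, Fin.ext_iff]; omega
  have n2 : lo r ≠ hi s := by simp [lo, hi, Fin.ext_iff]; omega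
  have n3 : hi s ≠ lo r := n2.symm
  have n4 : hi s ≠ hi r := by simp [hi, Fin.ext_iff]; omega
  have a0 : ∀ u : Tableau lam, axial κ s (swapEntry r u) = axial κ r u + axial κ s u := by
    intro u
    rw [axial, ← hmid, content_swap_hi, content_swap_ne κ r u n3 n4, axial, axial, ← hmid]
    ring
  have a1 : ∀ u : Tableau lam, axial κ r (swapEntry s u) = axial κ r u + axial κ s u := by
    intro u
    rw [axial, hmid, content_swap_lo, content_swap_ne κ s u n1 n2, axial, axial, ← hmid]
    ring
  have hb := α.braid ⟨t, ht⟩ r s h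
  have e1 : ∀ r, extendZero (α.coeff r) t = α.coeff r ⟨t, ht⟩ := fun r => by
    simp only [extendZero, dif_pos ht]
  simp only [← e1] at hb
  have mr := coeff_mul_coeff α hP ht r
  have ms := coeff_mul_coeff α hP ht s
  have zr := coeff_eq_zero α t r
  have zs := coeff_eq_zero α t s
  have xr := qInt_axial_ne_zero hP ht r
  have xs := qInt_axial_ne_zero hP ht s
  have yr : IsStandard (swapEntry r t) → qInt ξ (axial κ r t + axial κ s t) ≠ 0 := fun h' => by
    have := qInt_axial_ne_zero hP h' s
    rwa [a0] at this
  have ys : IsStandard (swapEntry s t) → qInt ξ (axial κ r t + axial κ s t) ≠ 0 := fun h' => by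
    have := qInt_axial_ne_zero hP h' r
    rwa [a1] at this
  have hbad := ht.axial_eq_of_not κ h
  have hsum := qInt_add ξ (axial κ r t) (axial κ s t)
  rw [zpow_eq_qInt] at hsum
  have hneg : ∀ k : ℤ, (qInt ξ (-k))⁻¹ = -(1 + ((ξ : K) - 1) * qInt ξ k) * (qInt ξ k)⁻¹ := by
    intro k
    have i1 := qInt_neg ξ k
    rw [zpow_eq_qInt] at i1
    have i2 : 1 + ((ξ : K) - 1) * qInt ξ k ≠ 0 := by
      rw [← zpow_eq_qInt]
      exact Units.ne_zero _
    have i3 : qInt ξ (-k) = -qInt ξ k / (1 + ((ξ : K) - 1) * qInt ξ k) := by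
      rw [eq_div_iff i2]
      linear_combination i1
    rw [i3, inv_div, div_neg, div_eq_mul_inv, neg_mul]
  simp only [Module.End.mul_apply, opT_stdVec, map_sub, map_smul, swapEntry_swapEntry, a0, a1,
    axial_swap, swapEntry_braid t h]
  simp only [show axial κ r t + axial κ s t + -axial κ s t = axial κ r t by ring,
    show -axial κ r t + (axial κ r t + axial κ s t) = axial κ s t by ring, hneg]
  generalize qInt ξ (axial κ r t + axial κ s t) = C at *
  have hAB : ¬ IsStandard (swapEntry r t) → ¬ IsStandard (swapEntry s t) →
      qInt ξ (axial κ r t) = qInt ξ (axial κ s t) := fun h1 h2 => by rw [hbad h1 h2]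
  generalize qInt ξ (axial κ r t) = A at *
  generalize qInt ξ (axial κ s t) = B at *
  generalize extendZero (α.coeff r) t = a at *
  generalize extendZero (α.coeff s) t = b at *
  generalize extendZero (α.coeff r) (swapEntry r t) = a' at *
  generalize extendZero (α.coeff s) (swapEntry s t) = b' at *
  have ha : a * a' = -((1 + ξ * A) * (1 - A)) / A ^ 2 := by
    rw [eq_div_iff (pow_ne_zero 2 xr)]
    exact mr
  have hb' : b * b' = -((1 + ξ * B) * (1 - B)) / B ^ 2 := by
    rw [eq_div_iff (pow_ne_zero 2 xs)]
    exact ms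
  have cr : a * (-(C⁻¹ * ((1 + ((ξ : K) - 1) * A) * A⁻¹)) + A⁻¹ * B⁻¹ - B⁻¹ * C⁻¹) = 0 := by
    by_cases h1 : IsStandard (swapEntry r t)
    · have hC := yr h1
      field_simp
      linear_combination a * hsum
    · rw [zr h1, zero_mul]
  have cs : b * (A⁻¹ * C⁻¹ + C⁻¹ * ((1 + ((ξ : K) - 1) * B) * B⁻¹) - A⁻¹ * B⁻¹) = 0 := by
    by_cases h1 : IsStandard (swapEntry s t)
    · have hC := ys h1
      field_simp
      linear_combination -b * hsum
    · rw [zs h1, zero_mul]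
  have ct : -(a * a' * C⁻¹) - A⁻¹ * A⁻¹ * B⁻¹ + b * b' * C⁻¹ + B⁻¹ * B⁻¹ * A⁻¹ = 0 := by
    by_cases hC : C = 0
    · have h1 : ¬ IsStandard (swapEntry r t) := fun h1 => yr h1 hC
      have h2 : ¬ IsStandard (swapEntry s t) := fun h2 => ys h2 hC
      rw [hC, hAB h1 h2]
      ring
    · rw [ha, hb']
      field_simp
      linear_combination (A - B) * hsum
  linear_combination (norm := module) ct • stdVec K t + cr • stdVec K (swapEntry r t) +
    cs • stdVec K (swapEntry s t) +
    hb • stdVec K (swapEntry s (swapEntry r (swapEntry s t)))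

end specht

/-- The action of the cyclotomic Hecke algebra in seminormal form. -/
def spechtRep {K : Type*} [Field K] {ξ : Kˣ} {ℓ : ℕ} {κ : Fin ℓ → ℤ} {n : ℕ}
    (hP : semisimpleParam ξ κ n ≠ 0) (α : SeminormalSystem ξ κ n) (lam : Multipartition ℓ n) :
    Hecke ξ κ n →ₐ[K] Module.End K (StdTableau lam →₀ K) :=
  Hecke.lift ξ κ n (opL ξ κ lam) (opT α lam) specht_cyc (specht_quad α hP) specht_LL
    (specht_TT α) (specht_braid α hP) (specht_TL α) (specht_succ α hP)

/-- The Specht module `S^λ`: the vector space with basis the standard `λ`-tableaux, with the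
seminormal action of the cyclotomic Hecke algebra. -/
def Specht {K : Type*} [Field K] {ξ : Kˣ} {ℓ : ℕ} {κ : Fin ℓ → ℤ} {n : ℕ}
    (_ : semisimpleParam ξ κ n ≠ 0) (_ : SeminormalSystem ξ κ n)
    (lam : Multipartition ℓ n) : Type _ := StdTableau lam →₀ K

section module

variable {K : Type*} [Field K] {ξ : Kˣ} {ℓ : ℕ} {κ : Fin ℓ → ℤ} {n : ℕ}
  (hP : semisimpleParam ξ κ n ≠ 0) (α : SeminormalSystem ξ κ n) (lam : Multipartition ℓ n)

instance : AddCommGroup (Specht hP α lam) := inferInstanceAs (AddCommGroup (StdTableau lam →₀ K))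

instance : Module K (Specht hP α lam) := inferInstanceAs (Module K (StdTableau lam →₀ K))

instance : Module (Hecke ξ κ n) (Specht hP α lam) :=
  Module.compHom (StdTableau lam →₀ K) (spechtRep hP α lam).toRingHom

/-- The basis `f_t` of the Specht module. -/
def spechtBasis : Module.Basis (StdTableau lam) K (Specht hP α lam) :=
  Module.Basis.ofRepr (LinearEquiv.refl K (StdTableau lam →₀ K))

theorem heckeL_smul (k : Fin n) (t : StdTableau lam) :
    heckeL ξ κ k • spechtBasis hP α lam t =
      qInt ξ (content κ t.1 k) • spechtBasis hP α lam t := by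
  have h : spechtBasis hP α lam t = stdVec K t.1 := (stdVec_val t).symm
  have h1 : heckeL ξ κ k • spechtBasis hP α lam t =
    spechtRep hP α lam (heckeL ξ κ k) (spechtBasis hP α lam t) := rfl
  rw [h1, spechtRep, Hecke.lift_heckeL, h]
  exact opL_stdVec t.1 k

theorem heckeT_smul (r : Fin (n - 1)) (t : StdTableau lam) :
    heckeT ξ κ r • spechtBasis hP α lam t =
      α.coeff r t • extendZero (fun u => spechtBasis hP α lam u) (swapEntry r t.1) -
        (qInt ξ (axial κ r t.1))⁻¹ • spechtBasis hP α lam t := by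
  have h : spechtBasis hP α lam t = stdVec K t.1 := (stdVec_val t).symm
  have h1 : heckeT ξ κ r • spechtBasis hP α lam t =
    spechtRep hP α lam (heckeT ξ κ r) (spechtBasis hP α lam t) := rfl
  rw [h1, spechtRep, Hecke.lift_heckeT, h]
  refine (opT_stdVec α t.1 r).trans ?_
  simp only [extendZero, dif_pos t.2]
  rfl

end module
end

end CycHecke

/-! The Jucys-Murphy elements act diagonally on the seminormal basis: `f_t` has weight `([c_1(t)],
…, [c_n(t)])`. Since `P_H ≠ 0`, these weights separate all standard tableaux of all shapes
(`IsStdSeq.eq_of_qInt_eq`). The hash map turns the eigenvalue `[c]` of `L_k` on `f_t` into `[-c]`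
(`hash_heckeL_smul`), and because the multicharge is symmetric, negating every content of `t` gives
the contents of the conjugate tableau, which has shape `λ'`. So for `λ ≠ λ'` no weight of `S^λ` is a
negated weight of `S^λ`.

Interpolating over both finite sets of weights gives, for each `t`, a polynomial `F_t` in the `L_k`
that projects `S^λ` onto the line of `f_t`, while `F_t^#` acts on `S^λ` as zero
(`exists_seminormal_idempotent`). As `#` is an involution, `h + h^#` lies in the alternating algebra
for every `h`, and it acts as `h` whenever `h^#` acts as zero. This applies to `F_t` and to every
product `F_t h`, so such elements preserve any submodule `N` over the alternating algebra.

If `N ≠ 0`, some `F_t` extracts a basis vector `f_t` from `N`. Then `F_{s_r t} T_r` carries `f_t` to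
`α_r(t) f_{s_r t}`, and `α_r(t) ≠ 0` when `s_r t` is standard (`coeff_ne_zero`). Simple
transpositions connect all standard tableaux of one shape (`mem_of_swapEntry_closed`), so `N`
contains the whole basis.

Tableaux are compared as sequences of boxes, so that tableaux of different shapes, and conjugates,
live in one type. -/

namespace CycHecke

noncomputable section

/-! ### Separation of standard tableaux by their quantum contents -/

/-- A standard tableau, recorded as the sequence of boxes `(component, row, column)` containing
its successive entries. -/
structure IsStdSeq {ℓ n : ℕ} (p : Fin n → Fin ℓ × ℕ × ℕ) : Prop where
  injective : Function.Injective p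
  exists_le : ∀ (k : Fin n) (i : Fin ℓ) (a b : ℕ), i = (p k).1 → a ≤ (p k).2.1 → b ≤ (p k).2.2 →
    ∃ j ≤ k, p j = (i, a, b)

/-- The content of a box. -/
def boxContent {ℓ : ℕ} (κ : Fin ℓ → ℤ) (b : Fin ℓ × ℕ × ℕ) : ℤ :=
  κ b.1 + (b.2.2 : ℤ) - (b.2.1 : ℤ)

/-- The row boxes and the column boxes from row `c` on are disjoint and all occur among the first
`m` values of `p`. The offset `c` drops the corner that row and column share inside one component:
`c = 1` serves for equal components, `c = 0` for distinct ones. -/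
theorem card_add_card_le {ℓ n : ℕ} (p : Fin n → Fin ℓ × ℕ × ℕ) (m : ℕ) {i i' : Fin ℓ} {b a c : ℕ}
    (hrow : ∀ y < b, ∃ j : Fin n, (j : ℕ) < m ∧ p j = (i, 0, y))
    (hcol : ∀ x < a, ∃ j : Fin n, (j : ℕ) < m ∧ p j = (i', x, 0)) (h : i ≠ i' ∨ 0 < c) :
    b + (a - c) ≤ m := by
  let A : Finset (Fin ℓ × ℕ × ℕ) := (Finset.range b).image fun y => (i, 0, y)
  let B : Finset (Fin ℓ × ℕ × ℕ) := (Finset.range (a - c)).image fun x => (i', x + c, 0)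
  have hA : A.card = b := by
    rw [Finset.card_image_of_injective _ fun x y h => by simpa using h, Finset.card_range]
  have hB : B.card = a - c := by
    rw [Finset.card_image_of_injective _ fun x y h => by simpa using h, Finset.card_range]
  have hAB : Disjoint A B := by
    rw [Finset.disjoint_left]
    intro x hx hx'
    obtain ⟨y, -, rfl⟩ := Finset.mem_image.1 hx
    obtain ⟨z, -, hz⟩ := Finset.mem_image.1 hx'
    simp only [Prod.mk.injEq] at hz
    rcases h with h | h
    · exact h hz.1.symm
    · omega
  have hsub : A ∪ B ⊆ (Finset.univ.filter fun j : Fin n => (j : ℕ) < m).image p := by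
    intro x hx
    simp only [Finset.mem_image, Finset.mem_filter, Finset.mem_univ, true_and]
    rcases Finset.mem_union.1 hx with hx | hx
    · obtain ⟨y, hy, rfl⟩ := Finset.mem_image.1 hx
      exact hrow y (Finset.mem_range.1 hy)
    · obtain ⟨y, hy, rfl⟩ := Finset.mem_image.1 hx
      exact hcol (y + c) (by have := Finset.mem_range.1 hy; omega)
  have h1 := (Finset.card_le_card hsub).trans Finset.card_image_le
  have h2 : (Finset.univ.filter fun j : Fin n => (j : ℕ) < m).card ≤ (Finset.range m).card :=
    Finset.card_le_card_of_injOn Fin.val (fun j hj => by simpa using hj)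
      Fin.val_injective.injOn
  rw [Finset.card_union_of_disjoint hAB, hA, hB] at h1
  rw [Finset.card_range] at h2
  omega

/-- From `[a] = [b] + ξ^b [a - b]`. Equality of weights thus becomes the vanishing of one quantum
integer, which `P_H ≠ 0` can exclude. -/
theorem qInt_sub_eq_zero {K : Type*} [Field K] {ξ : Kˣ} {a b : ℤ} (h : qInt ξ a = qInt ξ b) :
    qInt ξ (a - b) = 0 := by
  have h1 := qInt_add ξ b (a - b)
  rw [add_sub_cancel, h, left_eq_add] at h1
  exact (mul_eq_zero.1 h1).resolve_left (Units.ne_zero _)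

/-- Standard tableaux of all shapes are separated by their quantum contents. -/
theorem IsStdSeq.eq_of_qInt_eq {K : Type*} [Field K] {ξ : Kˣ} {ℓ n : ℕ} {κ : Fin ℓ → ℤ}
    (hP : semisimpleParam ξ κ n ≠ 0) {p q : Fin n → Fin ℓ × ℕ × ℕ} (hp : IsStdSeq p)
    (hq : IsStdSeq q)
    (h : ∀ k, qInt ξ (boxContent κ (p k)) = qInt ξ (boxContent κ (q k))) : p = q := by
  have step : ∀ (m : ℕ) (hm : m < n), p ⟨m, hm⟩ = q ⟨m, hm⟩ := by
    intro m
    induction m using Nat.strong_induction_on with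
    | _ m ih =>
      intro hm
      have hk := qInt_sub_eq_zero (h ⟨m, hm⟩)
      -- Boxes weakly above and to the left of the box of entry `m`, other than that box itself,
      -- carry smaller entries.
      have earlier : ∀ {p : Fin n → Fin ℓ × ℕ × ℕ}, IsStdSeq p →
          ∀ a b, a ≤ (p ⟨m, hm⟩).2.1 → b ≤ (p ⟨m, hm⟩).2.2 →
          (a < (p ⟨m, hm⟩).2.1 ∨ b < (p ⟨m, hm⟩).2.2) →
          ∃ j : Fin n, (j : ℕ) < m ∧ p j = ((p ⟨m, hm⟩).1, a, b) := by
        intro p hp a b ha hb hab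
        obtain ⟨j, hj, e⟩ := hp.exists_le ⟨m, hm⟩ _ a b rfl ha hb
        refine ⟨j, lt_of_le_of_ne hj fun hjm => ?_, e⟩
        have hjm' : j = ⟨m, hm⟩ := Fin.ext hjm
        rw [hjm', Prod.ext_iff, Prod.ext_iff] at e
        simp only at e
        omega
      have hpq : ∀ (x : Fin ℓ × ℕ × ℕ), (∃ j : Fin n, (j : ℕ) < m ∧ q j = x) ↔
          ∃ j : Fin n, (j : ℕ) < m ∧ p j = x := fun x =>
        exists_congr fun j => and_congr_right fun hj => by rw [ih j hj j.2]
      -- By induction `p` and `q` agree before `m`, so both new boxes are added to the same diagram.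
      -- The arm of one and the leg of the other therefore fit among the `m` boxes already placed.
      have bound : ∀ c : ℕ, ((p ⟨m, hm⟩).1 ≠ (q ⟨m, hm⟩).1 ∨ 0 < c) →
          (p ⟨m, hm⟩).2.2 + ((q ⟨m, hm⟩).2.1 - c) ≤ m := fun c hc =>
        card_add_card_le p m
          (fun y hy => earlier hp 0 y (Nat.zero_le _) hy.le (Or.inr hy))
          (fun x hx => (hpq _).1 (earlier hq x 0 hx.le (Nat.zero_le _) (Or.inl hx))) hc
      have bound' : ∀ c : ℕ, ((q ⟨m, hm⟩).1 ≠ (p ⟨m, hm⟩).1 ∨ 0 < c) →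
          (q ⟨m, hm⟩).2.2 + ((p ⟨m, hm⟩).2.1 - c) ≤ m := fun c hc =>
        card_add_card_le p m
          (fun y hy => (hpq _).1 (earlier hq 0 y (Nat.zero_le _) hy.le (Or.inr hy)))
          (fun x hx => earlier hp x 0 hx.le (Nat.zero_le _) (Or.inl hx)) hc
      by_cases hc : (p ⟨m, hm⟩).1 = (q ⟨m, hm⟩).1
      · have b1 := bound 1 (Or.inr one_pos)
        have b2 := bound' 1 (Or.inr one_pos)
        -- With `c = 1` the contents differ by at most `m + 1 ≤ n` in absolute value, the range
        -- controlled by the factors `[1]⋯[n]`.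
        have heq : boxContent κ (p ⟨m, hm⟩) - boxContent κ (q ⟨m, hm⟩) = 0 := by
          by_contra hne
          refine qInt_ne_zero_of_abs hP hne ?_ hk
          simp only [boxContent, hc]
          rw [abs_le]
          omega
        simp only [boxContent, hc] at heq
        -- The two boxes lie on one diagonal. If they differed, one would be strictly above and to
        -- the left of the other, hence already placed before step `m`, contradicting injectivity.
        rcases lt_trichotomy (p ⟨m, hm⟩).2.1 (q ⟨m, hm⟩).2.1 with hlt | he | hlt
        · obtain ⟨j, hj, e⟩ := (hpq _).1 (earlier hq (p ⟨m, hm⟩).2.1 (p ⟨m, hm⟩).2.2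
            hlt.le (by omega) (Or.inl hlt))
          rw [← hc] at e
          have := congrArg Fin.val (hp.injective (a₂ := ⟨m, hm⟩) e)
          simp only at this
          omega
        · exact Prod.ext hc (Prod.ext he (by omega))
        · obtain ⟨j, hj, e⟩ := (hpq _).2 (earlier hp (q ⟨m, hm⟩).2.1 (q ⟨m, hm⟩).2.2
            hlt.le (by omega) (Or.inl hlt))
          rw [hc] at e
          have := congrArg Fin.val (hq.injective (a₂ := ⟨m, hm⟩) e)
          simp only at this
          omega
      -- With `c = 0` the shift `d` satisfies `|d| ≤ m < n`, the range of the second product in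
      -- `P_H`.
      · exfalso
        have b1 := bound 0 (Or.inl hc)
        have b2 := bound' 0 (Or.inl (Ne.symm hc))
        refine qInt_ne_zero_of_ne hP hc (d := ((p ⟨m, hm⟩).2.2 : ℤ) - (p ⟨m, hm⟩).2.1 -
          ((q ⟨m, hm⟩).2.2 - (q ⟨m, hm⟩).2.1)) (by rw [abs_lt]; omega) ?_
        rw [← hk]
        congr 1
        simp only [boxContent]
        ring
  funext k
  exact step k k.2

/-! ### Box sequences of tableaux and of their conjugates -/

section tableaux

variable {ℓ n : ℕ} {lam mu : Multipartition ℓ n}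

/-- The sequence of boxes of a tableau. -/
def boxSeq (t : Tableau lam) (k : Fin n) : Fin ℓ × ℕ × ℕ := (t.symm k).1

/-- The sequence of boxes of the conjugate tableau. -/
def conjBoxSeq (t : Tableau lam) (k : Fin n) : Fin ℓ × ℕ × ℕ :=
  ((t.symm k).comp.rev, (t.symm k).col, (t.symm k).row)

theorem IsStandard.isStdSeq {t : Tableau lam} (ht : IsStandard t) : IsStdSeq (boxSeq t) where
  injective _ _ h := t.symm.injective (Subtype.ext h)
  exists_le k i a b hi ha hb := by
    obtain ⟨c, h1, h2, h3⟩ := (t.symm k).exists_le ha hb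
    refine ⟨t c, ?_, ?_⟩
    · have := ht.le h1 (h2.le.trans ha) (h3.le.trans hb)
      rwa [Equiv.apply_symm_apply] at this
    · rw [boxSeq, Equiv.symm_apply_apply]
      exact Prod.ext (h1.trans hi.symm) (Prod.ext h2 h3)

theorem IsStandard.isStdSeq_conj {t : Tableau lam} (ht : IsStandard t) :
    IsStdSeq (conjBoxSeq t) where
  injective j k h := by
    simp only [conjBoxSeq, Prod.mk.injEq, Fin.rev_inj] at h
    exact t.symm.injective (Box.ext' h.1 h.2.2 h.2.1)
  exists_le k i a b hi ha hb := by
    obtain ⟨c, h1, h2, h3⟩ := (t.symm k).exists_le hb ha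
    refine ⟨t c, ?_, ?_⟩
    · have := ht.le h1 (h2.le.trans hb) (h3.le.trans ha)
      rwa [Equiv.apply_symm_apply] at this
    · simp only [conjBoxSeq, Equiv.symm_apply_apply, h1, h2, h3, hi]

theorem content_eq_boxContent (κ : Fin ℓ → ℤ) (t : Tableau lam) (k : Fin n) :
    content κ t k = boxContent κ (boxSeq t k) := rfl

/-- Transposing a box exchanges row and column, and reversing the components negates the charge;
this is where the symmetry of the multicharge enters the weights. -/
theorem neg_content_eq_boxContent {κ : Fin ℓ → ℤ} (hκ : κ = conjCharge κ) (t : Tableau lam)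
    (k : Fin n) : -content κ t k = boxContent κ (conjBoxSeq t k) := by
  have h : κ (t.symm k).comp.rev = -κ (t.symm k).comp := by
    conv_lhs => rw [hκ]
    simp [conjCharge]
  simp only [content, boxContent, conjBoxSeq, h]
  ring

theorem mem_comp_iff_exists_boxSeq (t : Tableau lam) (i : Fin ℓ) (c : ℕ × ℕ) :
    c ∈ lam.comp i ↔ ∃ k, boxSeq t k = (i, c) := by
  constructor
  · intro h
    exact ⟨t ⟨(i, c), h⟩, congrArg Subtype.val (t.symm_apply_apply ⟨(i, c), h⟩)⟩
  · rintro ⟨k, hk⟩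
    have := (t.symm k).2
    rwa [show (t.symm k).1 = (i, c) from hk] at this

theorem mem_conj_comp_iff_exists_conjBoxSeq (t : Tableau lam) (i : Fin ℓ) (c : ℕ × ℕ) :
    c ∈ lam.conj.comp i ↔ ∃ k, conjBoxSeq t k = (i, c) := by
  have h : c ∈ lam.conj.comp i ↔ c.swap ∈ lam.comp i.rev := by
    simp [Multipartition.conj, YoungDiagram.mem_transpose]
  rw [h, mem_comp_iff_exists_boxSeq t]
  refine exists_congr fun k => ?_
  simp only [boxSeq, conjBoxSeq, Prod.ext_iff, Prod.fst_swap, Prod.snd_swap, Box.comp, Box.row,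
    Box.col, Fin.rev_eq_iff]
  tauto

theorem eq_of_qInt_content_eq {K : Type*} [Field K] {ξ : Kˣ} {κ : Fin ℓ → ℤ}
    (hP : semisimpleParam ξ κ n ≠ 0) {s t : Tableau lam} (hs : IsStandard s) (ht : IsStandard t)
    (h : ∀ k, qInt ξ (content κ s k) = qInt ξ (content κ t k)) : s = t := by
  have e := IsStdSeq.eq_of_qInt_eq hP hs.isStdSeq ht.isStdSeq h
  have e' : s.symm = t.symm := Equiv.ext fun k => Subtype.ext (congrFun e k)
  rw [← s.symm_symm, e', t.symm_symm]

/-- The negated weight of `t` is the weight of its conjugate, so separation identifies the box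
sequence of `s` with that of the conjugate of `t`; the shape is the set of values of the sequence.
-/
theorem eq_conj_of_qInt_content_eq {K : Type*} [Field K] {ξ : Kˣ} {κ : Fin ℓ → ℤ}
    (hκ : κ = conjCharge κ) (hP : semisimpleParam ξ κ n ≠ 0) {s : Tableau mu} {t : Tableau lam}
    (hs : IsStandard s) (ht : IsStandard t)
    (h : ∀ k, qInt ξ (content κ s k) = qInt ξ (-content κ t k)) : mu = lam.conj := by
  have e := IsStdSeq.eq_of_qInt_eq hP hs.isStdSeq ht.isStdSeq_conj fun k => by
    rw [← content_eq_boxContent, h, neg_content_eq_boxContent hκ]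
  ext i c
  rw [YoungDiagram.mem_cells, YoungDiagram.mem_cells, mem_comp_iff_exists_boxSeq s,
    mem_conj_comp_iff_exists_conjBoxSeq t, e]

/-! ### Existence of standard tableaux and connectivity under simple transpositions -/

theorem finite_tableau (s : Tableau lam) : Finite (Tableau lam) := by
  have : Finite (Box lam) := Finite.of_equiv _ s.symm
  infer_instance

/-- A permutation without descents is an order automorphism of a finite chain, and the identity is
the only one. -/
theorem equiv_eq_refl_of_lo_lt_hi (g : Equiv.Perm (Fin n))
    (h : ∀ r : Fin (n - 1), g (lo r) < g (hi r)) : g = Equiv.refl _ := by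
  cases n with
  | zero => exact Subsingleton.elim _ _
  | succ n =>
    have hg : StrictMono g := Fin.strictMono_iff_lt_succ.2 fun i => h i
    ext k
    have := congrArg (fun f : Fin (n + 1) ≃o Fin (n + 1) => (f k : ℕ))
      (Subsingleton.elim (hg.orderIsoOfSurjective g g.surjective) (OrderIso.refl _))
    simpa using this

/-- Any two standard tableaux of the same shape are connected by simple transpositions. -/
theorem mem_of_swapEntry_closed (X : Set (Tableau lam)) (hstd : ∀ t ∈ X, IsStandard t)
    (hX : X.Nonempty)
    (hswap : ∀ t ∈ X, ∀ r, IsStandard (swapEntry r t) → swapEntry r t ∈ X)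
    {s : Tableau lam} (hs : IsStandard s) : s ∈ X := by
  have := finite_tableau s
  -- By the rearrangement principle this sum grows whenever a descent of `s ∘ u⁻¹` is removed, so a
  -- maximiser has no descent left and equals `s`.
  obtain ⟨u, hu, hmax⟩ := Set.exists_max_image X
    (fun u => ∑ k : Fin n, (k : ℕ) * (s (u.symm k) : ℕ)) X.toFinite hX
  have key : u.symm.trans s = Equiv.refl _ := by
    apply equiv_eq_refl_of_lo_lt_hi
    intro r
    by_contra hlt
    simp only [Equiv.trans_apply] at hlt
    have hne : s (u.symm (lo r)) ≠ s (u.symm (hi r)) := fun h =>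
      lo_ne_hi r (u.symm.injective (s.injective h))
    have hlt' : s (u.symm (hi r)) < s (u.symm (lo r)) := lt_of_le_of_ne (not_lt.1 hlt) hne.symm
    -- If the exchange broke standardness, the boxes of `r` and `r + 1` in `u` would be adjacent and
    -- in this order, and `s`, being standard, would have no descent there.
    have hstd' : IsStandard (swapEntry r u) := by
      by_contra hns
      obtain ⟨h1, h2⟩ := (hstd u hu).adjacent_of_not hns
      have := hs.le h1 (by omega) (by omega)
      exact absurd this (not_le.2 hlt')
    have hle := hmax _ (hswap u hu r hstd')
    simp only [symm_swapEntry] at hle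
    rw [← Finset.sum_erase_add _ _ (Finset.mem_univ (lo r)),
      ← Finset.sum_erase_add _ _ (Finset.mem_univ (lo r)),
      ← Finset.sum_erase_add _ _ (Finset.mem_erase.2 ⟨(lo_ne_hi r).symm, Finset.mem_univ _⟩),
      ← Finset.sum_erase_add _ _ (Finset.mem_erase.2 ⟨(lo_ne_hi r).symm, Finset.mem_univ _⟩),
      Equiv.swap_apply_left, Equiv.swap_apply_right] at hle
    have hsum : ∑ k ∈ (Finset.univ.erase (lo r)).erase (hi r),
        (k : ℕ) * (s (u.symm (Equiv.swap (lo r) (hi r) k)) : ℕ) =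
        ∑ k ∈ (Finset.univ.erase (lo r)).erase (hi r), (k : ℕ) * (s (u.symm k) : ℕ) := by
      refine Finset.sum_congr rfl fun k hk => ?_
      simp only [Finset.mem_erase, Finset.mem_univ, and_true] at hk
      rw [Equiv.swap_apply_of_ne_of_ne hk.2 hk.1]
    rw [hsum] at hle
    have e1 : ((lo r : Fin n) : ℕ) = r := rfl
    have e2 : ((hi r : Fin n) : ℕ) = r + 1 := rfl
    rw [Fin.lt_def] at hlt'
    rw [e1, e2] at hle
    -- The exchange changes the sum by `s (u⁻¹ r) - s (u⁻¹ (r + 1))`, which is positive at a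
    -- descent.
    nlinarith
  have : s = u := by
    ext b
    have := congrArg Fin.val (Equiv.congr_fun key (u b))
    simpa using this
  rwa [this]

/-- Every multipartition has a standard tableau. -/
theorem exists_isStandard (lam : Multipartition ℓ n) : ∃ t : Tableau lam, IsStandard t := by
  -- Row reading: boxes are numbered lexicographically by component, row and column. Moving right or
  -- down increases this order.
  let f : Box lam → Fin ℓ ×ₗ (ℕ ×ₗ ℕ) := fun b => toLex (b.comp, toLex (b.row, b.col))
  have hf : Function.Injective f := fun b b' h => by
    simp only [f, EmbeddingLike.apply_eq_iff_eq, Prod.mk.injEq] at h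
    exact Box.ext' h.1 h.2.1 h.2.2
  let e : Box lam ≃ Σ i, (lam.comp i).cells :=
    { toFun b := ⟨b.1.1, b.1.2, b.2⟩
      invFun x := ⟨(x.1, x.2.1), x.2.2⟩
      left_inv _ := rfl
      right_inv _ := rfl }
  let _ : Fintype (Box lam) := Fintype.ofEquiv _ e.symm
  let _ : LinearOrder (Box lam) := LinearOrder.lift' f hf
  have hcard : Fintype.card (Box lam) = n := by
    rw [Fintype.card_congr e, Fintype.card_sigma]
    simpa [YoungDiagram.card] using lam.sum_card
  let t := (Fintype.orderIsoFinOfCardEq (Box lam) hcard).symm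
  have hlt : ∀ b b' : Box lam, f b < f b' → t b < t b' := fun b b' h => t.lt_iff_lt.2 h
  refine ⟨t.toEquiv, fun b b' h1 h2 h3 => hlt b b' ?_, fun b b' h1 h2 h3 => hlt b b' ?_⟩
  · simp only [f, Prod.Lex.toLex_lt_toLex]
    exact Or.inr ⟨h1, Or.inr ⟨h2, h3⟩⟩
  · simp only [f, Prod.Lex.toLex_lt_toLex]
    exact Or.inr ⟨h1, Or.inl h3⟩

/-! ### Nonvanishing of the seminormal coefficients -/

/-- If `t` and `s_r t` are both standard then `ρ_r(t) ± 1` is not a zero of the quantum integer. -/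
theorem qInt_axial_add_ne_zero {K : Type*} [Field K] {ξ : Kˣ} {κ : Fin ℓ → ℤ}
    (hP : semisimpleParam ξ κ n ≠ 0) {t : Tableau lam} (ht : IsStandard t) {r : Fin (n - 1)}
    (hr : IsStandard (swapEntry r t)) : qInt ξ (1 + axial κ r t) ≠ 0 := by
  have b1 := hook_bound (t.symm (lo r)) (t.symm (hi r)) t
  have b2 := hook_bound (t.symm (hi r)) (t.symm (lo r)) t
  by_cases hc : (t.symm (lo r)).comp = (t.symm (hi r)).comp
  -- Since `t` and `s_r t` order the two boxes oppositely, the boxes are incomparable, so inside one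
  -- component their contents differ by at least `2` and `1 + ρ_r(t) ≠ 0`.
  · have hncomp : ∀ u : Tableau lam, IsStandard u →
        ¬ u (t.symm (lo r)) < u (t.symm (hi r)) →
        ¬ ((t.symm (lo r)).row ≤ (t.symm (hi r)).row ∧
          (t.symm (lo r)).col ≤ (t.symm (hi r)).col) := by
      rintro u hu h ⟨h1, h2⟩
      exact h (lt_of_le_of_ne (hu.le hc h1 h2) fun h =>
        lo_ne_hi r (t.symm.injective (u.injective h)))
    have n1 := hncomp _ hr (by
      simp [swapEntry, lo, hi, Fin.lt_def])
    refine qInt_ne_zero_of_abs hP ?_ ?_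
    · simp only [axial, content, hc]
      have n2 : ¬ ((t.symm (hi r)).row ≤ (t.symm (lo r)).row ∧
          (t.symm (hi r)).col ≤ (t.symm (lo r)).col) := by
        rintro ⟨h1, h2⟩
        have := ht.le hc.symm h1 h2
        simp [lo, hi, Fin.le_def] at this
      omega
    · simp only [axial, content, hc]
      rw [abs_le]
      omega
  -- Here `|d| < n` is needed although `d` contains the extra `1`, which `hook_bound` misses by one.
  -- In distinct components the full row and column are disjoint, corners included, which gains the
  -- missing unit.
  · have bound : ∀ b b' : Box lam, b.comp ≠ b'.comp → b.col + 1 + (b'.row + 1 - 0) ≤ n := by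
      intro b b' hne
      refine card_add_card_le (boxSeq t) n (i := b.comp) (i' := b'.comp)
        (fun y hy => ?_) (fun x hx => ?_) (Or.inl hne)
      · obtain ⟨c, h1, h2, h3⟩ := b.exists_le (Nat.zero_le _) (Nat.lt_succ_iff.1 hy)
        refine ⟨t c, (t c).2, ?_⟩
        rw [boxSeq, Equiv.symm_apply_apply]
        exact Prod.ext h1 (Prod.ext h2 h3)
      · obtain ⟨c, h1, h2, h3⟩ := b'.exists_le (Nat.lt_succ_iff.1 hx) (Nat.zero_le _)
        refine ⟨t c, (t c).2, ?_⟩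
        rw [boxSeq, Equiv.symm_apply_apply]
        exact Prod.ext h1 (Prod.ext h2 h3)
    have c1 := bound _ _ hc
    have c2 := bound _ _ (Ne.symm hc)
    have := qInt_ne_zero_of_ne hP hc
      (d := 1 + ((t.symm (lo r)).col : ℤ) - (t.symm (lo r)).row -
        ((t.symm (hi r)).col - (t.symm (hi r)).row)) (by rw [abs_lt]; omega)
    convert this using 2
    simp only [axial, content]
    ring

/-- Both numerator factors of `α_r(t) α_r(s_r t)` are nonzero, by the previous bound applied to `t`
and to `s_r t`. -/
theorem coeff_ne_zero {K : Type*} [Field K] {ξ : Kˣ} {κ : Fin ℓ → ℤ}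
    (hP : semisimpleParam ξ κ n ≠ 0) (α : SeminormalSystem ξ κ n) (t : StdTableau lam)
    {r : Fin (n - 1)} (hr : IsStandard (swapEntry r t.1)) : α.coeff r t ≠ 0 := by
  have h := α.mul_swap t ⟨_, hr⟩ r rfl
  refine left_ne_zero_of_mul (b := α.coeff r ⟨_, hr⟩) ?_
  rw [h]
  exact div_ne_zero
    (mul_ne_zero (qInt_axial_add_ne_zero hP t.2 hr)
      (qInt_axial_add_ne_zero hP hr (by rw [swapEntry_swapEntry]; exact t.2)))
    (mul_ne_zero (qInt_axial_ne_zero hP t.2 r) (qInt_axial_ne_zero hP hr r))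

end tableaux

/-! ### The hash map is an involution -/

section involution

variable {R : Type*} [CommRing R] (ξ : Rˣ) {ℓ : ℕ} (κ : Fin ℓ → ℤ) {n : ℕ}
  (hκ : κ = conjCharge κ)

theorem hash_hash_heckeT (r : Fin (n - 1)) :
    hash ξ κ κ n hκ (hash ξ κ κ n hκ (heckeT ξ κ r)) = heckeT ξ κ r := by
  have h : hash ξ κ κ n hκ (heckeT ξ κ r) =
      algebraMap R (Hecke ξ κ n) ξ - 1 - heckeT ξ κ r := by
    rw [← hashT_eq, hash, Hecke.lift_heckeT]
  rw [h, map_sub, map_sub, AlgHom.commutes, map_one, h]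
  abel

/-- Write `Y = (ξ - 1) L + 1`. Applying `#` to `L^# Y = -L` gives `L^## Y^# = -L^#`; multiplying by
`Y` and using `Y^# Y = 1` yields `L^## = -L^# Y = L`, with no case distinction on `ξ = 1`. -/
theorem hash_hash_heckeL (k : Fin n) :
    hash ξ κ κ n hκ (hash ξ κ κ n hκ (heckeL ξ κ k)) = heckeL ξ κ k := by
  have hY := isUnit_affineL ξ κ k
  have hL : hash ξ κ κ n hκ (heckeL ξ κ k) * affineL ξ κ k = -heckeL ξ κ k := by
    rw [hash, Hecke.lift_heckeL, hashL, neg_mul, mul_assoc, Ring.inverse_mul_cancel _ hY, mul_one]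
  have h1 := congrArg (hash ξ κ κ n hκ) hL
  rw [map_mul, map_neg] at h1
  have h2 := hash_affineL_mul ξ κ κ hκ k
  calc _ = hash ξ κ κ n hκ (hash ξ κ κ n hκ (heckeL ξ κ k)) *
        (hash ξ κ κ n hκ (affineL ξ κ k) * affineL ξ κ k) := by rw [h2, mul_one]
    _ = heckeL ξ κ k := by rw [← mul_assoc, h1, neg_mul, hL, neg_neg]

theorem Hecke.algHom_ext {A : Type*} [Ring A] [Algebra R A] {f g : Hecke ξ κ n →ₐ[R] A}
    (hL : ∀ k, f (heckeL ξ κ k) = g (heckeL ξ κ k))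
    (hT : ∀ r, f (heckeT ξ κ r) = g (heckeT ξ κ r)) : f = g := by
  refine RingQuot.ringQuot_ext' R f g (FreeAlgebra.hom_ext (funext fun x => ?_))
  cases x with
  | L k => exact hL k
  | T r => exact hT r

/-- The hash map is an involution. -/
theorem hash_hash (h : Hecke ξ κ n) : hash ξ κ κ n hκ (hash ξ κ κ n hκ h) = h :=
  DFunLike.congr_fun (Hecke.algHom_ext ξ κ
    (f := (hash ξ κ κ n hκ).comp (hash ξ κ κ n hκ)) (g := AlgHom.id R _)
    (hash_hash_heckeL ξ κ hκ) (hash_hash_heckeT ξ κ hκ)) h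

/-- The sum over the orbit of an involution is fixed. This supplies all the elements of the
alternating algebra used below apart from scalars. -/
theorem add_hash_mem (h : Hecke ξ κ n) : h + hash ξ κ κ n hκ h ∈ altHecke ξ κ n hκ := by
  rw [altHecke, AlgHom.mem_equalizer, map_add, hash_hash, AlgHom.id_apply, add_comm]

end involution

/-! ### Weights and seminormal idempotents on the Specht module -/

section module

variable {K : Type*} [Field K] {ξ : Kˣ} {ℓ : ℕ} {κ : Fin ℓ → ℤ} {n : ℕ}
  (hP : semisimpleParam ξ κ n ≠ 0) (α : SeminormalSystem ξ κ n) (lam : Multipartition ℓ n)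
  (hκ : κ = conjCharge κ)

instance : IsScalarTower K (Hecke ξ κ n) (Specht hP α lam) where
  smul_assoc c h v := by
    exact DFunLike.congr_fun (map_smul (spechtRep hP α lam) c h) v

instance : SMulCommClass (Hecke ξ κ n) K (Specht hP α lam) where
  smul_comm h c v := (spechtRep hP α lam h).map_smul c v

theorem affineL_smul (k : Fin n) (t : StdTableau lam) :
    affineL ξ κ k • spechtBasis hP α lam t =
      ((ξ ^ content κ t.1 k : Kˣ) : K) • spechtBasis hP α lam t := by
  rw [affineL, ← Algebra.smul_def, add_smul, smul_assoc, heckeL_smul, one_smul, zpow_eq_qInt]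
  module

/-- The hash image of `L_k` is `-L_k Y_k⁻¹`, where `Y_k` has eigenvalue `ξ^c` on `f_t` with `c =
c_k(t)`, and `-[c] ξ^(-c) = [-c]`. -/
theorem hash_heckeL_smul (k : Fin n) (t : StdTableau lam) :
    hash ξ κ κ n hκ (heckeL ξ κ k) • spechtBasis hP α lam t =
      qInt ξ (-content κ t.1 k) • spechtBasis hP α lam t := by
  have hy : ((ξ ^ content κ t.1 k : Kˣ) : K) ≠ 0 := Units.ne_zero _
  have hinv : Ring.inverse (affineL ξ κ k) • spechtBasis hP α lam t =
      ((ξ ^ content κ t.1 k : Kˣ) : K)⁻¹ • spechtBasis hP α lam t := by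
    rw [eq_inv_smul_iff₀ hy, ← smul_comm, ← affineL_smul, smul_smul,
      Ring.inverse_mul_cancel _ (isUnit_affineL ξ κ k), one_smul]
  rw [hash, Hecke.lift_heckeL, hashL, neg_smul, mul_smul, hinv, smul_comm, heckeL_smul, smul_smul,
    ← neg_smul]
  congr 1
  have := qInt_neg ξ (content κ t.1 k)
  field_simp
  linear_combination -this

/-- An element of the Hecke algebra which, with its image under the hash map, acts diagonally on
the seminormal basis, through the same function of the spectrum of the Jucys-Murphy elements. -/
def ActsDiagonally (h : Hecke ξ κ n) (χ : (Fin n → K) → K) : Prop :=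
  ∀ s : StdTableau lam,
    h • spechtBasis hP α lam s =
      χ (fun k => qInt ξ (content κ s.1 k)) • spechtBasis hP α lam s ∧
    hash ξ κ κ n hκ h • spechtBasis hP α lam s =
      χ (fun k => qInt ξ (-content κ s.1 k)) • spechtBasis hP α lam s

/-- Interpolation on a finite set of weights. -/
theorem exists_actsDiagonally (w : Fin n → K) (W : Finset (Fin n → K)) :
    ∃ (h : Hecke ξ κ n) (χ : (Fin n → K) → K), ActsDiagonally hP α lam hκ h χ ∧ χ w = 1 ∧
      ∀ v ∈ W, v ≠ w → χ v = 0 := by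
  classical
  induction W using Finset.induction_on with
  | empty =>
    exact ⟨1, fun _ => 1, fun s => by rw [map_one, one_smul, one_smul]; exact ⟨rfl, rfl⟩, rfl,
      by simp⟩
  | insert v W _ ih =>
    obtain ⟨h, χ, h1, h2, h3⟩ := ih
    by_cases hv : v = w
    · refine ⟨h, χ, h1, h2, fun u hu hne => ?_⟩
      rcases Finset.mem_insert.1 hu with rfl | hu
      · exact absurd hv hne
      · exact h3 u hu hne
    -- A Lagrange factor `(L_k - v_k) / (w_k - v_k)`, with `k` a coordinate separating `v` from `w`,
    -- kills the weight `v` and is `1` at `w`. Its hash image is the same polynomial in `L_k^#`, so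
    -- one function `χ` describes both actions.
    · obtain ⟨k, hk⟩ := Function.ne_iff.1 hv
      have hk' : w k - v k ≠ 0 := sub_ne_zero.2 (Ne.symm hk)
      refine ⟨(w k - v k)⁻¹ • ((heckeL ξ κ k - algebraMap K _ (v k)) * h),
        fun u => (w k - v k)⁻¹ * ((u k - v k) * χ u), fun s => ⟨?_, ?_⟩, ?_, fun u hu hne => ?_⟩
      · rw [smul_assoc, mul_smul, (h1 s).1, sub_smul, Algebra.algebraMap_eq_smul_one,
          smul_assoc (v k), one_smul, smul_comm (heckeL ξ κ k), heckeL_smul]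
        module
      · rw [map_smul, map_mul, map_sub, AlgHom.commutes, smul_assoc, mul_smul, (h1 s).2,
          sub_smul, Algebra.algebraMap_eq_smul_one, smul_assoc (v k), one_smul,
          smul_comm (hash ξ κ κ n hκ (heckeL ξ κ k)), hash_heckeL_smul]
        module
      · beta_reduce
        rw [h2, mul_one, inv_mul_cancel₀ hk']
      · rcases Finset.mem_insert.1 hu with rfl | hu
        · beta_reduce
          rw [sub_self, zero_mul, mul_zero]
        · simp only [h3 u hu hne, mul_zero]

variable {lam}

/-- The seminormal idempotent of a standard tableau, which projects onto a basis vector and whose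
image under the hash map acts by zero. -/
theorem exists_seminormal_idempotent (hlam : lam ≠ lam.conj) (t : StdTableau lam) :
    ∃ h : Hecke ξ κ n, h • spechtBasis hP α lam t = spechtBasis hP α lam t ∧
      (∀ s, s ≠ t → h • spechtBasis hP α lam s = 0) ∧
      ∀ s, hash ξ κ κ n hκ h • spechtBasis hP α lam s = 0 := by
  classical
  have := finite_tableau t.1
  have := Fintype.ofFinite (StdTableau lam)
  -- The two families are the weights through which `h` and its hash image act. The weight of `t`
  -- occurs once in the first, by separation, and never in the second, since that would force `λ =
  -- λ'`.
  obtain ⟨h, χ, h1, h2, h3⟩ := exists_actsDiagonally hP α lam hκ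
    (fun k => qInt ξ (content κ t.1 k))
    ((Finset.univ.image fun (s : StdTableau lam) k => qInt ξ (content κ s.1 k)) ∪
      Finset.univ.image fun (s : StdTableau lam) k => qInt ξ (-content κ s.1 k))
  refine ⟨h, ?_, fun s hs => ?_, fun s => ?_⟩
  · rw [(h1 t).1, h2, one_smul]
  · rw [(h1 s).1, h3, zero_smul]
    · exact Finset.mem_union_left _ (Finset.mem_image_of_mem _ (Finset.mem_univ s))
    · exact fun e => hs (Subtype.ext (eq_of_qInt_content_eq hP s.2 t.2 (congrFun e)))
  · rw [(h1 s).2, h3, zero_smul]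
    · exact Finset.mem_union_right _ (Finset.mem_image_of_mem _ (Finset.mem_univ s))
    · exact fun e => hlam (eq_conj_of_qInt_content_eq hκ hP t.2 s.2 (congrFun e.symm))

theorem smul_eq_zero_of_basis {h : Hecke ξ κ n}
    (hh : ∀ s, h • spechtBasis hP α lam s = 0) (v : Specht hP α lam) : h • v = 0 :=
  DFunLike.congr_fun (Module.Basis.ext (spechtBasis hP α lam)
    (f₁ := Module.toModuleEnd K (Specht hP α lam) h) (f₂ := 0) hh) v

theorem smul_eq_repr_smul {h : Hecke ξ κ n} {t : StdTableau lam}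
    (ht : h • spechtBasis hP α lam t = spechtBasis hP α lam t)
    (hh : ∀ s, s ≠ t → h • spechtBasis hP α lam s = 0) (v : Specht hP α lam) :
    h • v = (spechtBasis hP α lam).repr v t • spechtBasis hP α lam t := by
  refine DFunLike.congr_fun (Module.Basis.ext (spechtBasis hP α lam)
    (f₁ := Module.toModuleEnd K (Specht hP α lam) h)
    (f₂ := ((spechtBasis hP α lam).coord t).smulRight (spechtBasis hP α lam t)) fun s => ?_) v
  by_cases hs : s = t
  · subst hs
    simpa using ht
  · simpa [Finsupp.single_apply, hs] using hh s hs

/-! ### Submodules over the alternating algebra -/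

variable (N : Submodule (altHecke ξ κ n hκ) (Specht hP α lam))

/-- Scalars are fixed by the hash map, so a submodule over the alternating algebra is a
`K`-subspace. -/
theorem smul_mem_of_altHecke (c : K) {v : Specht hP α lam} (hv : v ∈ N) : c • v ∈ N := by
  have := N.smul_mem (algebraMap K (altHecke ξ κ n hκ) c) hv
  have e : algebraMap K (altHecke ξ κ n hκ) c • v = c • v := by
    change algebraMap K (Hecke ξ κ n) c • v = c • v
    rw [Algebra.algebraMap_eq_smul_one, smul_assoc, one_smul]
  rwa [e] at this

/-- A submodule over the alternating algebra is stable under every element of the Hecke algebra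
whose hash image acts by zero. -/
theorem smul_mem_of_hash_smul_eq_zero {h : Hecke ξ κ n}
    (hh : ∀ s, hash ξ κ κ n hκ h • spechtBasis hP α lam s = 0) {v : Specht hP α lam}
    (hv : v ∈ N) : h • v ∈ N := by
  -- The fixed element `h + h^#` acts on the Specht module exactly as `h` does.
  have h1 := N.smul_mem ⟨_, add_hash_mem ξ κ hκ h⟩ hv
  have e : (⟨_, add_hash_mem ξ κ hκ h⟩ : altHecke ξ κ n hκ) • v = h • v := by
    change (h + hash ξ κ κ n hκ h) • v = h • v
    rw [add_smul, smul_eq_zero_of_basis hP α hh, add_zero]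
  rwa [e] at h1

/-- The idempotent of `s_r t` removes the diagonal term of `T_r f_t` and leaves `α_r(t) f_{s_r t}`,
whose coefficient is invertible. -/
theorem spechtBasis_swap_mem (hlam : lam ≠ lam.conj) {t : StdTableau lam} {r : Fin (n - 1)}
    (hr : IsStandard (swapEntry r t.1)) (ht : spechtBasis hP α lam t ∈ N) :
    spechtBasis hP α lam ⟨swapEntry r t.1, hr⟩ ∈ N := by
  obtain ⟨h, h1, h2, h3⟩ := exists_seminormal_idempotent hP α hκ hlam ⟨swapEntry r t.1, hr⟩
  have hne : t ≠ ⟨swapEntry r t.1, hr⟩ := fun e => by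
    have e1 := congrArg (fun u : StdTableau lam => u.1.symm (lo r)) e
    simp only [symm_swapEntry, Equiv.swap_apply_left] at e1
    exact lo_ne_hi r (t.1.symm.injective e1)
  -- Although `T_r` is not fixed by `#`, the hash image of the product ends with the hash image of
  -- the idempotent, which annihilates everything.
  have hmem := smul_mem_of_hash_smul_eq_zero hP α hκ N (h := h * heckeT ξ κ r)
    (fun s => by rw [map_mul, mul_smul]; exact smul_eq_zero_of_basis hP α h3 _) ht
  rw [mul_smul, heckeT_smul, smul_sub, smul_comm, smul_comm h, h2 t hne, smul_zero, sub_zero] at hmem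
  simp only [extendZero, dif_pos hr, h1] at hmem
  have := smul_mem_of_altHecke hP α hκ N (α.coeff r t)⁻¹ hmem
  rwa [inv_smul_smul₀ (coeff_ne_zero hP α t hr)] at this

/-- A nonzero vector has a nonzero coordinate at some `t`; the idempotent of `t` isolates `f_t`
inside `N`, and the moves `t ↦ s_r t` spread membership to the whole basis. -/
theorem eq_top_of_ne_bot (hlam : lam ≠ lam.conj) (hN : N ≠ ⊥) : N = ⊤ := by
  obtain ⟨v, hv, hv0⟩ := N.exists_mem_ne_zero_of_ne_bot hN
  obtain ⟨t, ht⟩ : ∃ t, (spechtBasis hP α lam).repr v t ≠ 0 := by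
    by_contra! h
    exact hv0 ((spechtBasis hP α lam).repr.map_eq_zero_iff.1 (Finsupp.ext h))
  have htN : spechtBasis hP α lam t ∈ N := by
    obtain ⟨h, h1, h2, h3⟩ := exists_seminormal_idempotent hP α hκ hlam t
    have hmem := smul_mem_of_hash_smul_eq_zero hP α hκ N h3 hv
    rw [smul_eq_repr_smul hP α h1 h2] at hmem
    have := smul_mem_of_altHecke hP α hκ N ((spechtBasis hP α lam).repr v t)⁻¹ hmem
    rwa [inv_smul_smul₀ ht] at this
  have hall : ∀ s : StdTableau lam, spechtBasis hP α lam s ∈ N := by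
    intro s
    have := mem_of_swapEntry_closed
      {u : Tableau lam | ∃ hu : IsStandard u, spechtBasis hP α lam ⟨u, hu⟩ ∈ N}
      (fun _ h => h.1) ⟨t.1, t.2, htN⟩
      (fun u hu r hr => ⟨hr, spechtBasis_swap_mem hP α hκ N hlam (t := ⟨u, hu.1⟩) hr hu.2⟩) s.2
    exact this.2
  refine (Submodule.eq_top_iff').2 fun x => ?_
  rw [← (spechtBasis hP α lam).linearCombination_repr x, Finsupp.linearCombination_apply]
  exact N.sum_mem fun s _ => smul_mem_of_altHecke hP α hκ N _ (hall s)

end module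

end

end CycHecke

theorem mainTheorem4 {K : Type*} [Field K] (ξ : Kˣ) (hξ : 2 < CycHecke.quantumChar ξ)
    {ℓ : ℕ} (κ : Fin ℓ → ℤ) (hκ : κ = CycHecke.conjCharge κ) (n : ℕ)
    (hP : CycHecke.semisimpleParam ξ κ n ≠ 0)
    (α : CycHecke.SeminormalSystem ξ κ n)
    (lam : CycHecke.Multipartition ℓ n) (hlam : lam ≠ lam.conj) :
    IsSimpleModule (CycHecke.altHecke ξ κ n hκ) (CycHecke.Specht hP α lam) := by
  -- Simplicity includes being nonzero, which is the existence of a standard tableau.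
  obtain ⟨t, ht⟩ := CycHecke.exists_isStandard lam
  have : Nontrivial (CycHecke.Specht hP α lam) :=
    ⟨_, 0, (CycHecke.spechtBasis hP α lam).ne_zero ⟨t, ht⟩⟩
  rw [isSimpleModule_iff]
  exact { eq_bot_or_eq_top := fun N => or_iff_not_imp_left.2
            (CycHecke.eq_top_of_ne_bot hP α hκ N hlam) }
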